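/- Let $\gamma=\{\gamma_{\mathfrak u}\}$ be strictly positive weights indexed by the finite subsets $\mathfrak u$ of $\mathbb N=\{1,2,\dots\}$, with $\gamma_\emptyset=1$. For $s,N\in\mathbb N$ and $z\in\mathbb Z^s$ put $$T_{1,\gamma}(N,z)=\sum_{\substack{0\ne m\in\{-(N-1),\dots,N-1\}^s\\ m\cdot z\equiv 0\ (\mathrm{mod}\ N)}}\gamma_{\mathrm{supp}(m)}\prod_{j\in\mathrm{supp}(m)}\frac1{|m_j|},\qquad \mathrm{supp}(m)=\{j: m_j\neq0\}.$$ For $n\in\mathbb N$, $1\le v\le n$, $r\ge1$ and odd integers $z_1,\dots,z_{r-1},x$ let $$h_{r,n,v,\gamma}(x)=\sum_{t=v}^n\frac1{2^{t-v}}\sum_{\substack{k=1\\ k\text{ odd}}}^{2^t-1}\Bigl[\sum_{\emptyset\ne\mathfrak u\subseteq\{1,\dots,r-1\}}\gamma_{\mathfrak u}\prod_{j\in\mathfrak u}\log\frac1{\sin^2(\pi kz_j/2^t)}+\sum_{\mathfrak u\subseteq\{1,\dots,r-1\}}\gamma_{\mathfrak u\cup\{r\}}\log\frac1{\sin^2(\pi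 kx/2^v)}\prod_{j\in\mathfrak u}\log\frac1{\sin^2(\pi kz_j/2^t)}\Bigr].$$ The component-by-component digit-by-digit (CBC-DBD) construction with input $n$, $s$, $\gamma$ sets $z_1=1$ and, successively for $r=2,\dots,s$, sets $z_{r,1}=1$, then for $v=2,\dots,n$ sets $z_{r,v}=z_{r,v-1}+z^*2^{v-1}$, where $z^*\in\{0,1\}$ minimizes $z\mapsto h_{r,n,v,\gamma}(z_{r,v-1}+z\,2^{v-1})$ over $\{0,1\}$ (ties being broken arbitrarily), and finally sets $z_r=z_{r,n}$. Its output is $z=(z_1,\dots,z_s)$. **Theorem.** (1) There is an absolute constant $a>0$, in particular independent of $s$ and $N$, such that for all positive weights $\gamma$ as above, all $n,s\in\mathbb N$, with $N=2^n$, and every output $z$ of the CBC-DBD construction for $n,s,\gamma$, $$T_{1,\gamma}(N,z)\le(1+\log N)\sum_{\emptyset\ne\mathfrak u\subseteq\{1,\dots,s\}}\frac{\gamma_{\mathfrak u}}N\,(a\log N)^{|\mathfrak u|}.$$ (2) If the weights $\gamma$ moreover satisfy $\sum_{j\ge1}\tilde\gamma_j<\infty$, where $\tilde\gamma_j=\max_{\mathfrak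 v\subseteq\{1,\dots,j-1\}}\gamma_{\mathfrak v\cup\{j\}}/\gamma_{\mathfrak v}$, then for every $\delta>0$ there is a constant $C_\delta>0$, depending on $\gamma$ and $\delta$ but independent of $s$ and $N$, such that for all $n,s\in\mathbb N$, with $N=2^n$, and every output $z$ of the CBC-DBD construction for $n,s,\gamma$, $$T_{1,\gamma}(N,z)\le\frac{C_\delta}{N^{1-\delta}}.$$ -/

import Mathlib

noncomputable section

/-- Strictly positive weights `γ_u`, indexed by the finite sets `u` of positive integers, with the
normalization `γ_∅ = 1`. The values at sets containing `0` are never used. -/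
def IsPositiveWeights (γ : Finset ℕ → ℝ) : Prop :=
  γ ∅ = 1 ∧ ∀ u : Finset ℕ, 0 ∉ u → 0 < γ u

/-- The support `{j ∈ {1,…,s} : m_j ≠ 0}` of `m ∈ ℤ^s`, whose components are indexed by `1,…,s`. -/
def latticeSupp {s : ℕ} (m : ↥(Finset.Icc 1 s) → ℤ) : Finset ℕ :=
  (Finset.univ.filter fun j => m j ≠ 0).map (Function.Embedding.subtype _)

/-- `r_{α,γ}(m) = γ_{supp m}⁻¹ ∏_{j ∈ supp m} |m_j|^α`. -/
def rFun (α : ℝ) (γ : Finset ℕ → ℝ) {s : ℕ} (m : ↥(Finset.Icc 1 s) → ℤ) : ℝ :=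
  (γ (latticeSupp m))⁻¹ *
    ∏ j ∈ Finset.univ.filter (fun j => m j ≠ 0), |(m j : ℝ)| ^ α

/-- The box `M_{N,s} = {-(N-1),…,N-1}^s`. -/
def boxM (N s : ℕ) : Finset (↥(Finset.Icc 1 s) → ℤ) :=
  Fintype.piFinset fun _ => Finset.Icc (-((N : ℤ) - 1)) ((N : ℤ) - 1)

/-- `T_{α,γ}(N,z)`, the sum of `1 / r_{α,γ}(m)` over the `m ∈ M_{N,s} \ {0}` with
`m · z ≡ 0 (mod N)`. Only the components `z 1, …, z s` of `z` matter. -/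
def truncT (α : ℝ) (γ : Finset ℕ → ℝ) (N s : ℕ) (z : ℕ → ℤ) : ℝ :=
  ∑ m ∈ (boxM N s).filter
      (fun m => m ≠ 0 ∧ (∑ j : ↥(Finset.Icc 1 s), m j * z j) ≡ 0 [ZMOD (N : ℤ)]),
    1 / rFun α γ m

/-- `log (1 / sin² (π k x / 2^t))`. -/
def logInvSinSq (k : ℕ) (x : ℤ) (t : ℕ) : ℝ :=
  Real.log (1 / Real.sin (Real.pi * (k : ℝ) * (x : ℝ) / 2 ^ t) ^ 2)

/-- The digit-wise quality function `h_{r,n,v,γ}(x)`; it depends on `z 1, …, z (r-1)`. -/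
def digitQuality (γ : Finset ℕ → ℝ) (n : ℕ) (z : ℕ → ℤ) (r v : ℕ) (x : ℤ) : ℝ :=
  ∑ t ∈ Finset.Icc v n, (1 / 2 ^ (t - v) : ℝ) *
    ∑ k ∈ (Finset.Icc 1 (2 ^ t - 1)).filter (fun k => k % 2 = 1),
      ((∑ u ∈ (Finset.Icc 1 (r - 1)).powerset.erase ∅,
          γ u * ∏ j ∈ u, logInvSinSq k (z j) t) +
        ∑ u ∈ (Finset.Icc 1 (r - 1)).powerset,
          γ (u ∪ {r}) * logInvSinSq k x v * ∏ j ∈ u, logInvSinSq k (z j) t)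

/-- `(z 1, …, z s)` is an output of the component-by-component digit-by-digit construction for
`N = 2^n` and the weights `γ`. Here `Z r v` is the intermediate value `z_{r,v}` of the `r`-th
component after `v` binary digits; a tie in the minimization may be broken either way. -/
def IsCBCDBDOutput (γ : Finset ℕ → ℝ) (n s : ℕ) (z : ℕ → ℤ) : Prop :=
  ∃ Z : ℕ → ℕ → ℤ,
    Z 1 n = 1 ∧
    (∀ r ∈ Finset.Icc 2 s, Z r 1 = 1) ∧
    (∀ r ∈ Finset.Icc 2 s, ∀ v ∈ Finset.Icc 2 n,
      ∃ b ∈ ({0, 1} : Set ℤ),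
        IsMinOn (fun c : ℤ => digitQuality γ n z r v (Z r (v - 1) + c * 2 ^ (v - 1))) {0, 1} b ∧
        Z r v = Z r (v - 1) + b * 2 ^ (v - 1)) ∧
    ∀ r ∈ Finset.Icc 1 s, z r = Z r n

/-- `γ̃_j`, the maximum of `γ_{v ∪ {j}} / γ_v` over `v ⊆ {1,…,j-1}`. -/
def gammaTilde (γ : Finset ℕ → ℝ) (j : ℕ) : ℝ :=
  (Finset.Icc 1 (j - 1)).powerset.sup' (Finset.powerset_nonempty _)
    fun v => γ (v ∪ {j}) / γ v

end

open Finset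

/-! The mean of `log (1 / sin² (πx))` over a period is `log 4`, and its other Fourier coefficients
are `1 / |m|`. Sort the dual vectors by their support `u ∪ {r}`, where `r` is the largest element.
Allowing zero entries at the coordinates in `u`, with coefficient `log 4`, only enlarges the sum. By
orthogonality of characters, `N * T` is then bounded by sums over `k mod N` of truncated series:
close to `log (1 / sin²)` at `j ∈ u`, and close to `log (1 / sin²) - log 4` at `r`
(`truncT_le_sum_cosSum`).

Without truncation, the part with `k ≠ 0` is nonpositive for each `r` (`greedy_component_le`). For
`r ≥ 2` this is the method of conditional expectations. Up to terms that do not depend on the new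
digit, the quality function is a conditional mean over the undetermined digits. Choosing the smaller
value never increases this mean, which starts at or below the value obtained by replacing `log (1 /
sin²)` with `log 4` (`greedy_digits_le`). For `r = 1` the inequality is a direct computation.

What remains is the term `k = 0` and the truncation error. At a point `x` the error is at most `2 /
(N |sin (πx)|)`, and summed over the nonzero residues it is `O(1 + log N)` (`sum_inv_mul_sin_le`).
Every factor is `O(log N)`, which gives the first bound. For the second, the weighted sum is
dominated by a product over coordinates that summability makes smaller than any power of `N`, up to
a constant (`exists_prod_one_add_mul_le_exp`). -/

/-! ### Truncated Fourier series of `log (1 / sin²)` -/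

/-- Along the segment from `0` to `z`, the remainder of the logarithm series has derivative of norm
at most `2 t ^ M / ‖1 - z‖`; integrating this gives the factor `1 / (M + 1)`. -/
theorem norm_log_one_sub_add_sum_le (M : ℕ) {z : ℂ} (hz : ‖z‖ = 1) (hz1 : z ≠ 1) :
    ‖Complex.log (1 - z) + ∑ m ∈ range M, z ^ (m + 1) / ((m : ℂ) + 1)‖
      ≤ 2 / ((M + 1) * ‖1 - z‖) := by
  have hpos : 0 < ‖1 - z‖ := norm_pos_iff.mpr (sub_ne_zero.mpr (Ne.symm hz1))
  have hre1 : z.re < 1 := by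
    rcases lt_or_eq_of_le (hz ▸ Complex.re_le_norm z) with h | h
    · exact h
    · exfalso
      apply hz1
      have h2 : z.re * z.re + z.im * z.im = 1 := by
        have := Complex.normSq_eq_norm_sq z
        rw [hz, Complex.normSq_apply] at this
        simpa using this
      have h3 : z.im = 0 := by
        rw [h] at h2
        have : z.im * z.im = 0 := by linarith
        exact mul_self_eq_zero.mp this
      apply Complex.ext <;> simp [h, h3]
  have hslit : ∀ t : ℝ, t ∈ Set.Icc (0 : ℝ) 1 → (1 - z * t) ∈ Complex.slitPlane := by
    intro t ht
    left
    simp only [Complex.sub_re, Complex.one_re, Complex.mul_re, Complex.ofReal_re,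
      Complex.ofReal_im, mul_zero, sub_zero]
    rcases ht with ⟨h0, h1⟩
    by_cases hr : 0 ≤ z.re
    · nlinarith
    · nlinarith
  let f : ℝ → ℂ := fun t =>
    Complex.log (1 - z * t) + ∑ m ∈ range M, (z * t) ^ (m + 1) / ((m : ℂ) + 1)
  let f' : ℝ → ℂ := fun t => -z / (1 - z * t) + ∑ m ∈ range M, z * (z * t) ^ m
  have hf : ∀ t ∈ Set.Icc (0 : ℝ) 1, HasDerivAt f (f' t) t := by
    intro t ht
    have h0 : HasDerivAt (fun t : ℝ => z * (t : ℂ)) z t := by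
      simpa using (Complex.ofRealCLM.hasDerivAt (x := t)).const_mul z
    refine HasDerivAt.add ?_ ?_
    · have h1 : HasDerivAt (fun t : ℝ => 1 - z * (t : ℂ)) (-z) t := by
        simpa using h0.const_sub 1
      exact h1.clog_real (hslit t ht)
    · refine HasDerivAt.fun_sum fun m _ => ?_
      have h2 := (h0.pow (m + 1)).div_const ((m : ℂ) + 1)
      have hm : (m : ℂ) + 1 ≠ 0 := by exact_mod_cast Nat.succ_ne_zero m
      have e : z * (z * (t : ℂ)) ^ m
          = ((m + 1 : ℕ) : ℂ) * (z * (t : ℂ)) ^ (m + 1 - 1) * z / ((m : ℂ) + 1) := by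
        rw [Nat.add_sub_cancel]
        push_cast
        field_simp
      rw [e]
      exact h2
  have hf'le : ∀ t ∈ Set.Ico (0 : ℝ) 1, ‖f' t‖ ≤ 2 / ‖1 - z‖ * t ^ M := by
    intro t ht
    have hne : (1 - z * t) ≠ 0 := Complex.slitPlane_ne_zero (hslit t ⟨ht.1, ht.2.le⟩)
    have e : f' t = -z * (z * t) ^ M / (1 - z * t) := by
      have hg := geom_sum_mul (z * (t : ℂ)) M
      simp only [f']
      rw [← mul_sum]
      field_simp
      linear_combination (-z) * hg
    rw [e]
    simp only [norm_div, norm_mul, norm_neg, norm_pow, hz, one_mul, Complex.norm_real,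
      Real.norm_eq_abs, abs_of_nonneg ht.1]
    have h1 : 1 - t ≤ ‖1 - z * t‖ := by
      have := norm_sub_norm_le (1 : ℂ) (z * t)
      simpa [hz, abs_of_nonneg ht.1] using this
    -- Moving from `zt` to `z` costs `1 - t`, which is itself at most `‖1 - zt‖`. This makes the
    -- denominator uniform in `t`.
    have h2 : ‖1 - z‖ ≤ 2 * ‖1 - z * t‖ := by
      have : 1 - z = (1 - z * t) + z * ((t - 1 : ℝ) : ℂ) := by push_cast; ring
      have h3 : ‖1 - z‖ ≤ ‖1 - z * t‖ + ‖z * ((t - 1 : ℝ) : ℂ)‖ := by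
        conv_lhs => rw [this]
        exact norm_add_le _ _
      have h4 : ‖z * ((t - 1 : ℝ) : ℂ)‖ = 1 - t := by
        rw [norm_mul, hz, Complex.norm_real, Real.norm_eq_abs, abs_of_nonpos (by linarith [ht.2])]
        ring
      linarith
    have hp2 : 0 < ‖1 - z * t‖ := norm_pos_iff.mpr hne
    rw [div_le_iff₀ hp2, div_mul_eq_mul_div, div_mul_eq_mul_div, le_div_iff₀ hpos]
    have : 0 ≤ t ^ M := pow_nonneg ht.1 M
    nlinarith
  let B : ℝ → ℝ := fun t => 2 / ‖1 - z‖ * (t ^ (M + 1) / (M + 1))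
  have hB : ∀ t : ℝ, HasDerivAt B (2 / ‖1 - z‖ * t ^ M) t := by
    intro t
    have h := ((hasDerivAt_pow (M + 1) t).div_const ((M : ℝ) + 1)).const_mul (2 / ‖1 - z‖)
    have e : 2 / ‖1 - z‖ * t ^ M
        = 2 / ‖1 - z‖ * (((M + 1 : ℕ) : ℝ) * t ^ (M + 1 - 1) / ((M : ℝ) + 1)) := by
      rw [Nat.add_sub_cancel]
      push_cast
      field_simp
    rw [e]
    exact h
  have key := image_norm_le_of_norm_deriv_right_le_deriv_boundary (f := f) (f' := f')
    (a := 0) (b := 1) (fun t ht => (hf t ht).continuousAt.continuousWithinAt)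
    (fun t ht => (hf t ⟨ht.1, ht.2.le⟩).hasDerivWithinAt) (B := B)
    (by simp [f, B]) hB hf'le (Set.right_mem_Icc.mpr zero_le_one)
  simp only [f, B, Complex.ofReal_one, mul_one, one_pow] at key
  refine key.trans (le_of_eq ?_)
  field_simp

/-- The truncated Fourier series `∑_{0 < |m| ≤ M} e^{2πimx} / |m|`. -/
noncomputable def cosSum (M : ℕ) (x : ℝ) : ℝ :=
  ∑ m ∈ range M, 2 * Real.cos (2 * Real.pi * (m + 1) * x) / ((m : ℝ) + 1)

theorem norm_one_sub_exp (x : ℝ) :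
    ‖1 - Complex.exp (2 * Real.pi * x * Complex.I)‖ = 2 * |Real.sin (Real.pi * x)| := by
  have h := Complex.norm_exp_I_mul_ofReal_sub_one (2 * Real.pi * x)
  rw [norm_sub_rev]
  have e : (2 * Real.pi * x * Complex.I : ℂ) = Complex.I * ((2 * Real.pi * x : ℝ) : ℂ) := by
    push_cast; ring
  rw [e, h, norm_mul]
  simp only [Real.norm_eq_abs]
  rw [abs_of_pos (by norm_num : (0:ℝ) < 2)]
  congr 3
  ring

/-- Twice the real part of the logarithm estimate at `z = e^{2πix}`, where `‖1 - z‖ = 2 |sin (πx)|`;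
the factor `2` here is the source of `log 4`. -/
theorem abs_cosSum_add_log_four_sub_le (M : ℕ) {x : ℝ} (hx : Real.sin (Real.pi * x) ≠ 0) :
    |cosSum M x + Real.log 4 - Real.log (1 / Real.sin (Real.pi * x) ^ 2)|
      ≤ 2 / ((M + 1) * |Real.sin (Real.pi * x)|) := by
  set z := Complex.exp (2 * Real.pi * x * Complex.I) with hzdef
  have hn : ‖1 - z‖ = 2 * |Real.sin (Real.pi * x)| := norm_one_sub_exp x
  have hz : ‖z‖ = 1 := by
    have := Complex.norm_exp_ofReal_mul_I (2 * Real.pi * x)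
    push_cast at this
    exact this
  have hpos : 0 < |Real.sin (Real.pi * x)| := abs_pos.mpr hx
  have hz1 : z ≠ 1 := by
    intro h
    rw [h] at hn
    simp at hn
    exact hx hn
  have h := norm_log_one_sub_add_sum_le M hz hz1
  have hre := (Complex.abs_re_le_norm _).trans h
  have e1 : (∑ m ∈ range M, z ^ (m + 1) / ((m : ℂ) + 1)).re = cosSum M x / 2 := by
    rw [Complex.re_sum, cosSum, sum_div]
    refine sum_congr rfl fun m _ => ?_
    have : z ^ (m + 1) / ((m : ℂ) + 1)
        = Complex.exp ((2 * Real.pi * (m + 1) * x : ℝ) * Complex.I) / ((m + 1 : ℝ) : ℂ) := by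
      rw [hzdef, ← Complex.exp_nat_mul]
      push_cast
      congr 2
      ring
    rw [this, Complex.div_ofReal_re, Complex.exp_ofReal_mul_I_re]
    ring
  rw [Complex.add_re, Complex.log_re, e1, hn, Real.log_mul two_ne_zero hpos.ne', Real.log_abs] at hre
  have e2 : Real.log (1 / Real.sin (Real.pi * x) ^ 2) = -2 * Real.log (Real.sin (Real.pi * x)) := by
    rw [one_div, Real.log_inv, Real.log_pow]; push_cast; ring
  have e3 : Real.log 4 = 2 * Real.log 2 := by
    rw [show (4 : ℝ) = 2 ^ 2 by norm_num, Real.log_pow]; push_cast; ring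
  rw [e2, e3]
  have e4 : cosSum M x + 2 * Real.log 2 - -2 * Real.log (Real.sin (Real.pi * x))
      = 2 * (Real.log 2 + Real.log (Real.sin (Real.pi * x)) + cosSum M x / 2) := by ring
  rw [e4, abs_mul, abs_of_pos (by norm_num : (0:ℝ) < 2)]
  calc _ ≤ 2 * (2 / ((M + 1) * (2 * |Real.sin (Real.pi * x)|))) := by gcongr
    _ = _ := by field_simp

theorem sum_one_div_succ_le (M : ℕ) :
    ∑ m ∈ range M, 1 / ((m : ℝ) + 1) ≤ 1 + Real.log (M + 1) := by
  have h := harmonic_le_one_add_log M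
  have e : ((harmonic M : ℚ) : ℝ) = ∑ m ∈ range M, 1 / ((m : ℝ) + 1) := by
    simp [harmonic]
  rw [e] at h
  refine h.trans ?_
  rcases Nat.eq_zero_or_pos M with rfl | hM
  · simp
  · have : (0 : ℝ) < M := by exact_mod_cast hM
    gcongr
    linarith

theorem abs_cosSum_le (M : ℕ) (x : ℝ) : |cosSum M x| ≤ 2 * (1 + Real.log (M + 1)) := by
  refine (abs_sum_le_sum_abs _ _).trans ?_
  refine le_trans ?_ (mul_le_mul_of_nonneg_left (sum_one_div_succ_le M) zero_le_two)
  rw [mul_sum]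
  refine sum_le_sum fun m _ => ?_
  have : (0 : ℝ) < (m : ℝ) + 1 := by positivity
  rw [abs_div, abs_mul, abs_of_pos this, abs_of_pos (by norm_num : (0:ℝ) < 2), mul_one_div]
  gcongr
  have := Real.abs_cos_le_one (2 * Real.pi * (m + 1) * x)
  linarith

/-! ### Truncation errors summed over residues -/

theorem abs_sin_pi_mul_emod (N : ℕ) (hN : 0 < N) (a : ℤ) :
    |Real.sin (Real.pi * ((a % (N : ℤ) : ℤ) / (N : ℝ)))| = |Real.sin (Real.pi * (a / (N : ℝ)))| := by
  have hN' : (N : ℝ) ≠ 0 := by positivity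
  have h : (a : ℝ) = (a % (N : ℤ) : ℤ) + (N : ℝ) * (a / (N : ℤ) : ℤ) := by
    exact_mod_cast (Int.emod_add_mul_ediv a N).symm
  have e : Real.pi * (a / (N : ℝ))
      = Real.pi * ((a % (N : ℤ) : ℤ) / (N : ℝ)) + (a / (N : ℤ) : ℤ) * Real.pi := by
    conv_lhs => rw [h]
    field_simp
  rw [e, Real.sin_add_int_mul_pi, abs_mul]
  have : |(-1 : ℝ) ^ (a / (N : ℤ))| = 1 := by
    rw [abs_zpow]; simp
  rw [this, one_mul]

theorem inv_mul_sin_le {N k : ℕ} (hk : 0 < k) (hkN : k < N) :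
    1 / (N * |Real.sin (Real.pi * (k / (N : ℝ)))|) ≤ (1 / (k : ℝ) + 1 / ((N - k : ℕ) : ℝ)) / 2 := by
  have hk' : (0 : ℝ) < k := by exact_mod_cast hk
  have hNk : (0 : ℝ) < ((N - k : ℕ) : ℝ) := by
    have : 0 < N - k := by omega
    exact_mod_cast this
  have hN : (0 : ℝ) < N := by exact_mod_cast (hk.trans hkN)
  have hcast : ((N - k : ℕ) : ℝ) = N - k := by rw [Nat.cast_sub hkN.le]
  have aux : ∀ y : ℝ, 0 < y → y ≤ N / 2 → 2 * y / N ≤ |Real.sin (Real.pi * (y / N))| := by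
    intro y hy hyN
    have h1 : Real.pi * (y / N) ≤ Real.pi / 2 := by
      have : y / N ≤ 1 / 2 := by rw [div_le_iff₀ hN]; linarith
      nlinarith [Real.pi_pos]
    have h2 := Real.mul_le_sin (x := Real.pi * (y / N)) (by positivity) h1
    refine le_trans (le_of_eq ?_) (h2.trans (le_abs_self _))
    field_simp
  rcases le_total (k : ℝ) (N / 2) with h | h
  · have := aux k hk' h
    calc 1 / (N * |Real.sin (Real.pi * (k / (N : ℝ)))|) ≤ 1 / (N * (2 * k / N)) := by
          gcongr
      _ = (1 / (k : ℝ)) / 2 := by field_simp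
      _ ≤ _ := by
        have : 0 < 1 / ((N - k : ℕ) : ℝ) := by positivity
        linarith
  · have h3 := aux (N - k : ℕ) hNk (by rw [hcast]; linarith)
    have e : Real.sin (Real.pi * (((N - k : ℕ) : ℝ) / N)) = Real.sin (Real.pi * (k / (N : ℝ))) := by
      rw [← Real.sin_pi_sub, hcast]
      congr 1
      field_simp
      ring
    rw [e] at h3
    calc 1 / (N * |Real.sin (Real.pi * (k / (N : ℝ)))|) ≤ 1 / (N * (2 * (N - k : ℕ) / N)) := by
          gcongr
      _ = (1 / ((N - k : ℕ) : ℝ)) / 2 := by field_simp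
      _ ≤ _ := by
        have : 0 < 1 / (k : ℝ) := by positivity
        linarith

theorem toNat_emod_mem {N : ℕ} {a : ℤ} (ha : ¬ (N : ℤ) ∣ a) (hN : 0 < N) :
    (a % (N : ℤ)).toNat ∈ Icc 1 (N - 1) := by
  have h1 := Int.emod_nonneg a (show (N : ℤ) ≠ 0 by omega)
  have h2 := Int.emod_lt_of_pos a (show (0 : ℤ) < N by omega)
  have h3 : a % (N : ℤ) ≠ 0 := fun h => ha (Int.dvd_of_emod_eq_zero h)
  rw [mem_Icc]
  omega

theorem abs_sin_toNat_emod {N : ℕ} (hN : 0 < N) (a : ℤ) :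
    |Real.sin (Real.pi * (((a % (N : ℤ)).toNat : ℕ) / (N : ℝ)))|
      = |Real.sin (Real.pi * (a / (N : ℝ)))| := by
  rw [← abs_sin_pi_mul_emod N hN a]
  have h1 := Int.emod_nonneg a (show (N : ℤ) ≠ 0 by omega)
  have : (((a % (N : ℤ)).toNat : ℕ) : ℝ) = ((a % (N : ℤ) : ℤ) : ℝ) := by
    exact_mod_cast congrArg (fun i : ℤ => (i : ℝ)) (Int.toNat_of_nonneg h1)
  rw [this]

theorem inv_mul_abs_sin_le_one {N : ℕ} (hN : 0 < N) {a : ℤ} (ha : ¬ (N : ℤ) ∣ a) :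
    1 / (N * |Real.sin (Real.pi * (a / (N : ℝ)))|) ≤ 1 := by
  have hm := toNat_emod_mem ha hN
  rw [← abs_sin_toNat_emod hN]
  rw [mem_Icc] at hm
  refine (inv_mul_sin_le (by omega) (by omega)).trans ?_
  set k := (a % (N : ℤ)).toNat
  have h1 : 1 / (k : ℝ) ≤ 1 := by
    rw [div_le_one (by exact_mod_cast hm.1)]; exact_mod_cast hm.1
  have h2 : 1 / ((N - k : ℕ) : ℝ) ≤ 1 := by
    have : 1 ≤ N - k := by omega
    rw [div_le_one (by exact_mod_cast this)]; exact_mod_cast this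
  linarith

theorem sin_pi_mul_div_ne_zero {N : ℕ} (hN : 0 < N) {a : ℤ} (ha : ¬ (N : ℤ) ∣ a) :
    Real.sin (Real.pi * (a / (N : ℝ))) ≠ 0 := by
  intro h
  rw [Real.sin_eq_zero_iff] at h
  obtain ⟨b, hb⟩ := h
  have hN' : (N : ℝ) ≠ 0 := by positivity
  apply ha
  refine ⟨b, ?_⟩
  have : (a : ℝ) = N * b := by
    have hpi := Real.pi_ne_zero
    field_simp at hb
    linarith
  exact_mod_cast this

/-- Multiplication by a unit permutes the nonzero residues, so `z` plays no role. Then `|sin|` is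
bounded below by a chord on each half period, which leaves a harmonic sum. -/
theorem sum_inv_mul_sin_le {N : ℕ} (hN : 0 < N) {z : ℤ} (hz : IsCoprime (N : ℤ) z) :
    ∑ k ∈ Icc 1 (N - 1), 1 / (N * |Real.sin (Real.pi * (((k * z : ℤ) : ℝ) / (N : ℝ)))|)
      ≤ 1 + Real.log N := by
  have hnd : ∀ k : ℤ, 0 < k → k < N → ¬ (N : ℤ) ∣ k * z := by
    intro k h0 h1 hd
    exact absurd (Int.le_of_dvd h0 (hz.dvd_of_dvd_mul_right hd)) (by omega)
  let F : ℕ → ℝ := fun k => 1 / (N * |Real.sin (Real.pi * (k / (N : ℝ)))|)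
  let g : ℕ → ℕ := fun k => ((k * z : ℤ) % (N : ℤ)).toNat
  have hinj : Set.InjOn g (Icc 1 (N - 1) : Finset ℕ) := by
    intro a ha b hb hab
    rw [mem_coe, mem_Icc] at ha hb
    have h1 := Int.emod_nonneg (a * z : ℤ) (show (N : ℤ) ≠ 0 by omega)
    have h2 := Int.emod_nonneg (b * z : ℤ) (show (N : ℤ) ≠ 0 by omega)
    have h3 : (a * z : ℤ) % N = (b * z : ℤ) % N := by
      simp only [g] at hab
      omega
    have h4 : (N : ℤ) ∣ (a - b) * z := by
      rw [sub_mul]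
      exact Int.dvd_of_emod_eq_zero (Int.emod_eq_emod_iff_emod_sub_eq_zero.mp h3)
    obtain ⟨c, hc⟩ := hz.dvd_of_dvd_mul_right h4
    have h6 : c = 0 := by
      by_contra hne
      rcases lt_or_gt_of_ne hne with h | h
      · nlinarith [show (1 : ℤ) ≤ a from by omega, show (b : ℤ) ≤ N - 1 from by omega]
      · nlinarith [show (1 : ℤ) ≤ b from by omega, show (a : ℤ) ≤ N - 1 from by omega]
    rw [h6] at hc
    omega
  calc _ = ∑ k ∈ Icc 1 (N - 1), F (g k) := by
        refine sum_congr rfl fun k _ => ?_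
        simp only [F, g]
        rw [abs_sin_toNat_emod hN]
    _ = ∑ k ∈ (Icc 1 (N - 1)).image g, F k := (sum_image hinj).symm
    _ ≤ ∑ k ∈ Icc 1 (N - 1), F k := by
        refine sum_le_sum_of_subset_of_nonneg ?_ fun k _ _ => by positivity
        intro i hi
        obtain ⟨k, hk, rfl⟩ := mem_image.mp hi
        rw [mem_Icc] at hk
        exact toNat_emod_mem (hnd k (by omega) (by omega)) hN
    _ ≤ ∑ k ∈ Icc 1 (N - 1), (1 / (k : ℝ) + 1 / ((N - k : ℕ) : ℝ)) / 2 := by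
        refine sum_le_sum fun k hk => ?_
        rw [mem_Icc] at hk
        exact inv_mul_sin_le (by omega) (by omega)
    _ = ∑ m ∈ range (N - 1), 1 / ((m : ℝ) + 1) := by
        have e1 : ∑ k ∈ Icc 1 (N - 1), 1 / ((N - k : ℕ) : ℝ) = ∑ k ∈ Icc 1 (N - 1), 1 / (k : ℝ) := by
          refine sum_nbij' (fun k => N - k) (fun k => N - k) ?_ ?_ ?_ ?_ ?_
          · intro k hk; rw [mem_Icc] at *; omega
          · intro k hk; rw [mem_Icc] at *; omega
          · intro k hk; rw [mem_Icc] at *; omega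
          · intro k hk; rw [mem_Icc] at *; omega
          · intro k hk; rfl
        have e2 : ∑ k ∈ Icc 1 (N - 1), 1 / (k : ℝ) = ∑ m ∈ range (N - 1), 1 / ((m : ℝ) + 1) := by
          refine sum_nbij' (fun k => k - 1) (fun k => k + 1) ?_ ?_ ?_ ?_ ?_
          · intro k hk; rw [mem_Icc] at hk; rw [mem_range]; omega
          · intro k hk; rw [mem_range] at hk; rw [mem_Icc]; omega
          · intro k hk; rw [mem_Icc] at hk; omega
          · intro k hk; rfl
          · intro k hk
            rw [mem_Icc] at hk
            rw [Nat.cast_sub hk.1]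
            simp
        rw [← sum_div, sum_add_distrib, e1, e2]
        ring
    _ ≤ 1 + Real.log N := by
        refine (sum_one_div_succ_le (N - 1)).trans (le_of_eq ?_)
        rw [Nat.cast_sub hN]
        simp

/-! ### Character sums over the dual lattice -/

theorem sum_Icc_neg_eq (M : ℕ) (f : ℤ → ℂ) :
    ∑ m ∈ Icc (-(M : ℤ)) M, f m = f 0 + ∑ m ∈ range M, (f (m + 1) + f (-(m + 1))) := by
  induction M with
  | zero => simp
  | succ M ih =>
    have e : Icc (-((M + 1 : ℕ) : ℤ)) ((M + 1 : ℕ) : ℤ)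
        = insert ((M : ℤ) + 1) (insert (-((M : ℤ) + 1)) (Icc (-(M : ℤ)) M)) := by
      ext m
      simp only [mem_insert, mem_Icc]
      omega
    rw [e, sum_insert, sum_insert, ih, sum_range_succ]
    · ring
    · simp
    · simp only [mem_insert, mem_Icc]; omega

theorem sum_coef_mul_exp (M : ℕ) (c x : ℝ) :
    ∑ m ∈ Icc (-(M : ℤ)) M, ((if m = 0 then c else 1 / |(m : ℝ)| : ℝ) : ℂ) *
        Complex.exp (2 * Real.pi * (m * x) * Complex.I)
      = ((cosSum M x + c : ℝ) : ℂ) := by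
  rw [sum_Icc_neg_eq, cosSum, add_comm]
  push_cast
  congr 1
  · refine sum_congr rfl fun m _ => ?_
    have h1 : ((m : ℤ) + 1) ≠ 0 := by omega
    have h2 : -((m : ℤ) + 1) ≠ 0 := by omega
    have h3 : (0 : ℝ) < (m : ℝ) + 1 := by positivity
    rw [if_neg h1, if_neg h2]
    push_cast
    rw [abs_neg, abs_of_pos h3]
    have e : 2 * Complex.cos (2 * Real.pi * (m + 1) * x)
        = Complex.exp (2 * Real.pi * ((m + 1) * x) * Complex.I)
          + Complex.exp (2 * Real.pi * (-(m + 1) * x) * Complex.I) := by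
      rw [Complex.two_cos]
      congr 2 <;> ring
    rw [e]
    push_cast
    ring
  · simp

theorem sum_exp_range {N : ℕ} (hN : 0 < N) (a : ℤ) :
    ∑ k ∈ range N, Complex.exp (2 * Real.pi * (k * a / N) * Complex.I)
      = if (N : ℤ) ∣ a then (N : ℂ) else 0 := by
  have hN' : (N : ℂ) ≠ 0 := by exact_mod_cast hN.ne'
  have hpi : (2 * Real.pi * Complex.I : ℂ) ≠ 0 := Complex.two_pi_I_ne_zero
  set w := Complex.exp (2 * Real.pi * (a / N) * Complex.I) with hw
  have e : ∀ k : ℕ, Complex.exp (2 * Real.pi * (k * a / N) * Complex.I) = w ^ k := by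
    intro k
    rw [hw, ← Complex.exp_nat_mul]
    congr 1
    ring
  simp only [e]
  split_ifs with h
  · obtain ⟨b, rfl⟩ := h
    have : w = 1 := by
      rw [hw, Complex.exp_eq_one_iff]
      refine ⟨b, ?_⟩
      push_cast
      field_simp
    simp [this]
  · have hw1 : w ≠ 1 := by
      intro h1
      rw [hw, Complex.exp_eq_one_iff] at h1
      obtain ⟨b, hb⟩ := h1
      apply h
      refine ⟨b, ?_⟩
      have h2 : (2 * Real.pi * Complex.I : ℂ) * a = (2 * Real.pi * Complex.I) * (N * b) := by
        field_simp at hb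
        linear_combination (2 * Real.pi * Complex.I : ℂ) * hb
      exact_mod_cast mul_left_cancel₀ hpi h2
    have hwN : w ^ N = 1 := by
      rw [hw, ← Complex.exp_nat_mul, Complex.exp_eq_one_iff]
      refine ⟨a, ?_⟩
      field_simp
    rw [geom_sum_eq hw1, hwN]
    simp

theorem sum_dual_lattice_eq {ι : Type*} [Fintype ι] [DecidableEq ι] {N : ℕ} (hN : 0 < N)
    (A : Finset ℤ) (c : ι → ℤ → ℝ) (z : ι → ℤ) :
    (N : ℂ) * ∑ m ∈ (Fintype.piFinset fun _ : ι => A).filter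
        (fun m => (N : ℤ) ∣ ∑ j, m j * z j), ((∏ j, c j (m j) : ℝ) : ℂ)
      = ∑ k ∈ range N, ∏ j, ∑ m ∈ A, (c j m : ℂ) *
          Complex.exp (2 * Real.pi * (m * (((k * z j : ℤ) : ℝ) / (N : ℝ) : ℝ)) * Complex.I) := by
  simp only [prod_univ_sum]
  rw [sum_comm, sum_filter, mul_sum]
  refine sum_congr rfl fun m _ => ?_
  have e : ∀ k : ℕ, ∏ j, ((c j (m j) : ℂ) *
      Complex.exp (2 * Real.pi * (m j * (((k * z j : ℤ) : ℝ) / (N : ℝ) : ℝ)) * Complex.I))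
      = (∏ j, c j (m j) : ℝ)
        * Complex.exp (2 * Real.pi * (k * (∑ j, m j * z j : ℤ) / N) * Complex.I) := by
    intro k
    rw [prod_mul_distrib, ← Complex.exp_sum]
    push_cast
    congr 2
    rw [mul_sum, sum_div, mul_sum, sum_mul]
    refine sum_congr rfl fun j _ => ?_
    ring
  simp only [e]
  rw [← mul_sum, sum_exp_range hN]
  split_ifs <;> ring

/-! ### Sorting dual vectors by support -/

/-- Nonnegative coefficients dominating the indicator of the vectors with support `u ∪ {r}`: at the
coordinates in `u` the constant Fourier coefficient `log 4` of `log (1 / sin²)` is added. -/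
noncomputable def dominatingCoef (u : Finset ℕ) (r j : ℕ) (m : ℤ) : ℝ :=
  if j = r then (if m = 0 then 0 else 1 / |(m : ℝ)|)
  else if j ∈ u then (if m = 0 then Real.log 4 else 1 / |(m : ℝ)|)
  else if m = 0 then 1 else 0

theorem dominatingCoef_nonneg (u : Finset ℕ) (r j : ℕ) (m : ℤ) : 0 ≤ dominatingCoef u r j m := by
  unfold dominatingCoef
  have : 0 ≤ Real.log 4 := Real.log_nonneg (by norm_num)
  split_ifs <;> positivity

theorem sum_dominatingCoef_mul_exp (u : Finset ℕ) (r j M : ℕ) (x : ℝ) :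
    ∑ m ∈ Icc (-(M : ℤ)) M, (dominatingCoef u r j m : ℂ) *
        Complex.exp (2 * Real.pi * (m * x) * Complex.I)
      = ((if j = r then cosSum M x else if j ∈ u then cosSum M x + Real.log 4 else 1 : ℝ) : ℂ) := by
  unfold dominatingCoef
  split_ifs with h1 h2
  · rw [sum_coef_mul_exp]; simp
  · rw [sum_coef_mul_exp]
  · rw [sum_eq_single 0]
    · simp
    · intro m _ hm; simp [hm]
    · intro h; simp at h

theorem sum_dominatingCoef_eq {N : ℕ} (hN : 0 < N) {s r : ℕ} (hr : r ∈ Icc 1 s) {u : Finset ℕ}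
    (hu : u ⊆ Icc 1 (r - 1)) (z : ℕ → ℤ) :
    (N : ℝ) * ∑ m ∈ (boxM N s).filter (fun m => (N : ℤ) ∣ ∑ j : ↥(Icc 1 s), m j * z j),
        ∏ j : ↥(Icc 1 s), dominatingCoef u r j (m j)
      = ∑ k ∈ range N, cosSum (N - 1) (((k * z r : ℤ) : ℝ) / (N : ℝ)) *
          ∏ j ∈ u, (cosSum (N - 1) (((k * z j : ℤ) : ℝ) / (N : ℝ)) + Real.log 4) := by
  have h := sum_dual_lattice_eq hN (Icc (-((N : ℤ) - 1)) ((N : ℤ) - 1))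
    (fun j : ↥(Icc 1 s) => dominatingCoef u r j) (fun j => z j)
  have hM : (N : ℤ) - 1 = ((N - 1 : ℕ) : ℤ) := by omega
  rw [hM] at h
  simp only [sum_dominatingCoef_mul_exp] at h
  rw [← hM] at h
  have h' : (N : ℝ) * ∑ m ∈ (boxM N s).filter (fun m => (N : ℤ) ∣ ∑ j : ↥(Icc 1 s), m j * z j),
        ∏ j : ↥(Icc 1 s), dominatingCoef u r j (m j)
      = ∑ k ∈ range N, ∏ j : ↥(Icc 1 s), (if (j : ℕ) = r then
          cosSum (N - 1) (((k * z j : ℤ) : ℝ) / (N : ℝ)) else if (j : ℕ) ∈ u then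
          cosSum (N - 1) (((k * z j : ℤ) : ℝ) / (N : ℝ)) + Real.log 4 else 1) := by
    exact_mod_cast h
  rw [h']
  refine sum_congr rfl fun k _ => ?_
  rw [prod_coe_sort (Icc 1 s) (fun j => if j = r then
          cosSum (N - 1) (((k * z j : ℤ) : ℝ) / (N : ℝ)) else if j ∈ u then
          cosSum (N - 1) (((k * z j : ℤ) : ℝ) / (N : ℝ)) + Real.log 4 else 1),
    ← mul_prod_erase _ _ hr, if_pos rfl]
  congr 1
  have hsub : u ⊆ (Icc 1 s).erase r := by
    intro j hj
    have := hu hj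
    rw [mem_Icc] at this hr
    rw [mem_erase, mem_Icc]
    omega
  rw [← prod_subset hsub]
  · refine prod_congr rfl fun j hj => ?_
    rw [if_neg (mem_erase.mp (hsub hj)).1, if_pos hj]
  · intro j hj hju
    rw [if_neg (mem_erase.mp hj).1, if_neg hju]

/-- Nonempty sets are classified by their largest element `r`, which matches the order in which the
components are constructed. -/
theorem sum_powerset_Icc_erase_empty (s : ℕ) (g : Finset ℕ → ℝ) :
    ∑ u ∈ (Icc 1 s).powerset.erase ∅, g u
      = ∑ r ∈ Icc 1 s, ∑ u ∈ (Icc 1 (r - 1)).powerset, g (u ∪ {r}) := by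
  induction s with
  | zero => simp
  | succ s ih =>
    have hI : Icc 1 (s + 1) = insert (s + 1) (Icc 1 s) := by
      ext; simp only [mem_insert, mem_Icc]; omega
    have hn : s + 1 ∉ Icc 1 s := by simp
    have h1 := sum_erase_eq_sub (f := g) (empty_mem_powerset (Icc 1 (s + 1)))
    have h2 := sum_erase_eq_sub (f := g) (empty_mem_powerset (Icc 1 s))
    rw [h1, hI, sum_powerset_insert hn, sum_insert hn, ← ih, h2, Nat.add_sub_cancel]
    have : ∀ u : Finset ℕ, insert (s + 1) u = u ∪ {s + 1} := fun u => by rw [union_comm]; rfl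
    simp only [this]
    ring

theorem mem_latticeSupp {s : ℕ} (m : ↥(Icc 1 s) → ℤ) (j : ↥(Icc 1 s)) :
    (j : ℕ) ∈ latticeSupp m ↔ m j ≠ 0 := by
  simp [latticeSupp]

theorem one_div_rFun_eq {γ : Finset ℕ → ℝ} {s r : ℕ} {u : Finset ℕ} (m : ↥(Icc 1 s) → ℤ)
    (hm : latticeSupp m = u ∪ {r}) :
    1 / rFun 1 γ m = γ (u ∪ {r}) * ∏ j : ↥(Icc 1 s), dominatingCoef u r j (m j) := by
  rw [rFun, hm, one_div, mul_inv, inv_inv, ← prod_inv_distrib, prod_filter]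
  congr 1
  refine prod_congr rfl fun j _ => ?_
  have hj := mem_latticeSupp m j
  rw [hm, mem_union, mem_singleton] at hj
  unfold dominatingCoef
  by_cases h0 : m j = 0
  · have : ¬ ((j : ℕ) ∈ u ∨ (j : ℕ) = r) := fun h => hj.mp h h0
    push Not at this
    simp [h0, this.1, this.2]
  · have := hj.mpr h0
    by_cases hr : (j : ℕ) = r
    · simp [h0, hr]
    · simp [h0, hr, this.resolve_right hr]

theorem truncT_le_sum_cosSum {γ : Finset ℕ → ℝ} (hγ : IsPositiveWeights γ) {N : ℕ} (hN : 0 < N)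
    (s : ℕ) (z : ℕ → ℤ) :
    (N : ℝ) * truncT 1 γ N s z ≤ ∑ r ∈ Icc 1 s, ∑ u ∈ (Icc 1 (r - 1)).powerset, γ (u ∪ {r}) *
      ∑ k ∈ range N, cosSum (N - 1) (((k * z r : ℤ) : ℝ) / (N : ℝ)) *
          ∏ j ∈ u, (cosSum (N - 1) (((k * z j : ℤ) : ℝ) / (N : ℝ)) + Real.log 4) := by
  unfold truncT
  rw [← sum_fiberwise_of_maps_to (g := latticeSupp) (t := (Icc 1 s).powerset.erase ∅),
    sum_powerset_Icc_erase_empty, mul_sum]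
  · refine sum_le_sum fun r hr => ?_
    rw [mul_sum]
    refine sum_le_sum fun u hu => ?_
    rw [mem_powerset] at hu
    have hγ0 : 0 ≤ γ (u ∪ {r}) := by
      refine (hγ.2 _ fun h => ?_).le
      rw [mem_union, mem_singleton] at h
      rw [mem_Icc] at hr
      rcases h with h | h
      · have := hu h
        simp at this
      · omega
    rw [← sum_dominatingCoef_eq hN hr hu, mul_left_comm]
    refine mul_le_mul_of_nonneg_left ?_ (by positivity)
    rw [mul_sum]
    rw [sum_congr rfl fun m hm => one_div_rFun_eq (γ := γ) m (mem_filter.mp hm).2]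
    -- The exact-support condition is dropped here: vectors with smaller support contribute
    -- nonnegative terms.
    refine sum_le_sum_of_subset_of_nonneg ?_ fun m _ _ =>
      mul_nonneg hγ0 (prod_nonneg fun j _ => dominatingCoef_nonneg u r j (m j))
    intro m hm
    rw [mem_filter, mem_filter] at hm
    rw [mem_filter]
    exact ⟨hm.1.1, Int.modEq_zero_iff_dvd.mp hm.1.2.2⟩
  · intro m hm
    rw [mem_filter] at hm
    rw [mem_erase, mem_powerset]
    constructor
    · intro h
      apply hm.2.1
      funext j
      by_contra hne
      have := (mem_latticeSupp m j).mpr hne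
      simp [h] at this
    · intro j hj
      simp only [latticeSupp, mem_map] at hj
      obtain ⟨i, _, rfl⟩ := hj
      exact i.2

/-! ### Binary digits and `log (1 / sin²)` -/

theorem logInvSinSq_nonneg (k : ℕ) (x : ℤ) (t : ℕ) : 0 ≤ logInvSinSq k x t := by
  unfold logInvSinSq
  rw [one_div, Real.log_inv]
  have := Real.log_nonpos (sq_nonneg _) (Real.sin_sq_le_one (Real.pi * (k : ℝ) * (x : ℝ) / 2 ^ t))
  linarith

theorem logInvSinSq_eq (k : ℕ) (x : ℤ) (t : ℕ) :
    logInvSinSq k x t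
      = Real.log (1 / Real.sin (Real.pi * (((k * x : ℤ) : ℝ) / ((2 ^ t : ℕ) : ℝ))) ^ 2) := by
  unfold logInvSinSq
  push_cast
  congr 4
  ring

theorem logInvSinSq_two_mul (k : ℕ) (x : ℤ) (t : ℕ) :
    logInvSinSq (2 * k) x (t + 1) = logInvSinSq k x t := by
  unfold logInvSinSq
  congr 4
  push_cast
  field_simp
  ring

theorem logInvSinSq_add_mul_pow {w t : ℕ} (h : t ≤ w) (k : ℕ) (x c : ℤ) :
    logInvSinSq k (x + c * 2 ^ w) t = logInvSinSq k x t := by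
  unfold logInvSinSq
  obtain ⟨d, rfl⟩ := Nat.exists_eq_add_of_le h
  have e : Real.pi * (k : ℝ) * ((x + c * 2 ^ (t + d) : ℤ) : ℝ) / 2 ^ t
      = Real.pi * (k : ℝ) * (x : ℝ) / 2 ^ t + ((k * c * 2 ^ d : ℤ) : ℝ) * Real.pi := by
    push_cast
    field_simp
    ring
  rw [e, Real.sin_add_int_mul_pi, mul_pow, ← zpow_natCast, ← zpow_mul, mul_comm _ ((2 : ℕ) : ℤ),
    zpow_mul]
  simp

theorem sin_add_odd_mul_pi_div_two_sq (y : ℝ) {k : ℤ} (hk : Odd k) :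
    Real.sin (y + k * (Real.pi / 2)) ^ 2 = Real.cos y ^ 2 := by
  obtain ⟨c, rfl⟩ := hk
  have e : y + ((2 * c + 1 : ℤ) : ℝ) * (Real.pi / 2) = (y + c * Real.pi) + Real.pi / 2 := by
    push_cast; ring
  rw [e, Real.sin_add_pi_div_two, Real.cos_add_int_mul_pi, mul_pow, ← zpow_natCast, ← zpow_mul,
    mul_comm _ ((2 : ℕ) : ℤ), zpow_mul]
  simp

theorem log_inv_sin_sq_add_log_inv_cos_sq {y : ℝ} (h : Real.sin (2 * y) ≠ 0) :
    Real.log (1 / Real.sin y ^ 2) + Real.log (1 / Real.cos y ^ 2)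
      = Real.log (1 / Real.sin (2 * y) ^ 2) + Real.log 4 := by
  rw [Real.sin_two_mul] at *
  have hs : Real.sin y ≠ 0 := by rintro h0; simp [h0] at h
  have hc : Real.cos y ≠ 0 := by rintro h0; simp [h0] at h
  rw [← Real.log_mul (by positivity) (by positivity), ← Real.log_mul (by positivity) (by norm_num)]
  congr 1
  field_simp
  norm_num

/-- Flipping the digit at `2 ^ w` shifts the angle by an odd multiple of `π / 2`, turning `sin²`
into `cos²`; the identity is then `sin 2y = 2 sin y cos y`. Oddness and `1 ≤ w` keep `sin 2y`
nonzero. -/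
theorem logInvSinSq_add_half {k w : ℕ} {x : ℤ} (hk : Odd k) (hx : Odd x) (hw : 1 ≤ w) :
    logInvSinSq k x (w + 1) + logInvSinSq k (x + 2 ^ w) (w + 1)
      = logInvSinSq k x w + Real.log 4 := by
  unfold logInvSinSq
  have hk' : Odd (k : ℤ) := by exact_mod_cast hk
  have e1 : Real.pi * (k : ℝ) * ((x + 2 ^ w : ℤ) : ℝ) / 2 ^ (w + 1)
      = Real.pi * (k : ℝ) * (x : ℝ) / 2 ^ (w + 1) + ((k : ℤ) : ℝ) * (Real.pi / 2) := by
    push_cast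
    field_simp
    ring
  have e2 : Real.pi * (k : ℝ) * (x : ℝ) / 2 ^ w
      = 2 * (Real.pi * (k : ℝ) * (x : ℝ) / 2 ^ (w + 1)) := by
    field_simp
    ring
  rw [e1, sin_add_odd_mul_pi_div_two_sq _ hk', e2]
  apply log_inv_sin_sq_add_log_inv_cos_sq
  rw [← e2]
  have := sin_pi_mul_div_ne_zero (N := 2 ^ w) (by positivity) (a := k * x) (by
    intro hd
    have h2 : (2 : ℤ) ∣ k * x := by
      refine dvd_trans ?_ hd
      push_cast
      exact dvd_pow_self 2 (by omega)
    have := (hk'.mul hx)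
    rw [← Int.not_even_iff_odd] at this
    exact this (even_iff_two_dvd.mpr h2))
  convert this using 2
  push_cast
  ring

theorem logInvSinSq_one {k : ℕ} {x : ℤ} (hk : Odd k) (hx : Odd x) : logInvSinSq k x 1 = 0 := by
  have hk' : Odd ((k : ℤ) * x) := by
    have : Odd (k : ℤ) := by exact_mod_cast hk
    exact this.mul hx
  have h := sin_add_odd_mul_pi_div_two_sq 0 hk'
  unfold logInvSinSq
  have e : Real.pi * (k : ℝ) * (x : ℝ) / 2 ^ 1 = 0 + ((k * x : ℤ) : ℝ) * (Real.pi / 2) := by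
    push_cast; ring
  rw [e, h]
  simp

/-! ### Conditional means and the greedy choice of digits -/

/-- The odd integers in `{1, …, 2^t - 1}`. -/
def oddBelow (t : ℕ) : Finset ℕ := (Icc 1 (2 ^ t - 1)).filter (fun k => k % 2 = 1)

theorem odd_of_mem_oddBelow {t k : ℕ} (h : k ∈ oddBelow t) : Odd k :=
  Nat.odd_iff.mpr (mem_filter.mp h).2

/-- The mean of `log (1 / sin² (π k y / 2^t))` over the `y` with the same `v` lowest binary digits
as `x`. -/
noncomputable def digitMean (v t k : ℕ) (x : ℤ) : ℝ :=
  if t ≤ v then logInvSinSq k x t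
  else 1 / 2 ^ (t - v) * logInvSinSq k x v + (1 - 1 / 2 ^ (t - v)) * Real.log 4

theorem digitMean_succ_add {v t k : ℕ} {x : ℤ} (hv : 1 ≤ v) (hk : Odd k) (hx : Odd x) :
    digitMean (v + 1) t k x + digitMean (v + 1) t k (x + 2 ^ v) = 2 * digitMean v t k x := by
  have hd := logInvSinSq_add_half hk hx hv
  unfold digitMean
  rcases lt_trichotomy t (v + 1) with h | h | h
  · have hp := logInvSinSq_add_mul_pow (show t ≤ v by omega) k x 1
    rw [one_mul] at hp
    rw [if_pos (by omega), if_pos (by omega), if_pos (by omega), hp]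
    ring
  · subst h
    rw [if_pos le_rfl, if_pos le_rfl, if_neg (by omega), hd, Nat.add_sub_cancel_left]
    ring
  · rw [if_neg (by omega), if_neg (by omega), if_neg (by omega)]
    have e : t - v = (t - (v + 1)) + 1 := by omega
    rw [e, pow_succ]
    field_simp
    linear_combination hd

/-- Conditional expectations: the mean `E v` is the average of its two successors, so the better
digit does not increase it. At `v = n` no digit is free and `E n` is the actual sum. -/
theorem greedy_digits_le {n : ℕ} (hn : 1 ≤ n) (W : ℕ → ℕ → ℝ) (hW : ∀ t k, 0 ≤ W t k)
    (Z : ℕ → ℤ) (h1 : Z 1 = 1)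
    (hZ : ∀ v ∈ Icc 2 n, ∃ b ∈ ({0, 1} : Set ℤ),
      IsMinOn (fun c : ℤ => ∑ t ∈ Icc v n, (1 / 2 ^ (t - v) : ℝ) *
        ∑ k ∈ oddBelow t, W t k * logInvSinSq k (Z (v - 1) + c * 2 ^ (v - 1)) v) {0, 1} b ∧
      Z v = Z (v - 1) + b * 2 ^ (v - 1)) :
    ∑ t ∈ Icc 1 n, ∑ k ∈ oddBelow t, W t k * (logInvSinSq k (Z n) t - Real.log 4) ≤ 0 := by
  have hlog : 0 ≤ Real.log 4 := Real.log_nonneg (by norm_num)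
  let E : ℕ → ℤ → ℝ := fun v x => ∑ t ∈ Icc 1 n, ∑ k ∈ oddBelow t, W t k * digitMean v t k x
  let R : ℕ → ℤ → ℝ := fun v x => ∑ t ∈ Icc 1 n, ∑ k ∈ oddBelow t, W t k *
    (if t ≤ v then logInvSinSq k x t else (1 - 1 / 2 ^ (t - (v + 1))) * Real.log 4)
  -- The remainder `R v x` is free of `c`: levels `t ≤ v` do not see the new digit, and higher
  -- levels leave only a constant. Hence minimizing the quality function minimizes `E (v + 1)`.
  have hER : ∀ v x c, E (v + 1) (x + c * 2 ^ v) = (∑ t ∈ Icc (v + 1) n, (1 / 2 ^ (t - (v + 1)) : ℝ) *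
        ∑ k ∈ oddBelow t, W t k * logInvSinSq k (x + c * 2 ^ v) (v + 1)) + R v x := by
    intro v x c
    have hI : Icc (v + 1) n = (Icc 1 n).filter (fun t => v + 1 ≤ t) := by
      ext t; simp only [mem_filter, mem_Icc]; omega
    simp only [E, R]
    rw [hI, sum_filter, ← sum_add_distrib]
    refine sum_congr rfl fun t _ => ?_
    unfold digitMean
    rcases lt_trichotomy t (v + 1) with h | h | h
    · rw [if_neg (by omega), zero_add]
      refine sum_congr rfl fun k _ => ?_
      rw [if_pos (by omega), if_pos (by omega), logInvSinSq_add_mul_pow (by omega)]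
    · subst h
      rw [if_pos le_rfl, mul_sum, ← sum_add_distrib]
      refine sum_congr rfl fun k _ => ?_
      rw [if_pos le_rfl, if_neg (by omega), Nat.sub_self]
      simp
    · rw [if_pos h.le, mul_sum, ← sum_add_distrib]
      refine sum_congr rfl fun k _ => ?_
      rw [if_neg (by omega), if_neg (by omega)]
      ring
  have key : ∀ v, 1 ≤ v → v ≤ n → Odd (Z v) ∧
      E v (Z v) ≤ ∑ t ∈ Icc 1 n, ∑ k ∈ oddBelow t, W t k * Real.log 4 := by
    intro v hv
    induction v, hv using Nat.le_induction with
    | base =>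
      intro _
      rw [h1]
      refine ⟨odd_one, sum_le_sum fun t ht => sum_le_sum fun k hk => ?_⟩
      refine mul_le_mul_of_nonneg_left ?_ (hW t k)
      unfold digitMean
      -- At level `1` the angle is an odd multiple of `π / 2`, so the logarithm vanishes and the
      -- mean is at most `log 4`.
      have h0 := logInvSinSq_one (odd_of_mem_oddBelow hk) odd_one
      split_ifs with h
      · have : t = 1 := le_antisymm h (mem_Icc.mp ht).1
        rw [this, h0]
        exact hlog
      · rw [h0, mul_zero, zero_add]
        have : (0 : ℝ) ≤ 1 / 2 ^ (t - 1) := by positivity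
        nlinarith
    | succ v hv ih =>
      intro hvn
      obtain ⟨hodd, hle⟩ := ih (by omega)
      obtain ⟨b, hb, hmin, hZv⟩ := hZ (v + 1) (by rw [mem_Icc]; omega)
      rw [Nat.add_sub_cancel] at hmin hZv
      have heven : Even ((2 : ℤ) ^ v) := (even_two).pow_of_ne_zero (by omega)
      refine ⟨by rw [hZv]; exact hodd.add_even (heven.mul_left b), le_trans ?_ hle⟩
      have hm : ∀ c ∈ ({0, 1} : Set ℤ), E (v + 1) (Z (v + 1)) ≤ E (v + 1) (Z v + c * 2 ^ v) := by
        intro c hc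
        rw [hZv, hER, hER]
        have := isMinOn_iff.mp hmin c hc
        linarith
      have m0 := hm 0 (by simp)
      have m1 := hm 1 (by simp)
      rw [zero_mul, add_zero] at m0
      rw [one_mul] at m1
      have hs : E (v + 1) (Z v) + E (v + 1) (Z v + 2 ^ v) = 2 * E v (Z v) := by
        simp only [E]
        rw [← sum_add_distrib, mul_sum]
        refine sum_congr rfl fun t _ => ?_
        rw [← sum_add_distrib, mul_sum]
        refine sum_congr rfl fun k hk => ?_
        rw [← mul_add, digitMean_succ_add hv (odd_of_mem_oddBelow hk) hodd]
        ring
      linarith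
  have hfin := (key n hn le_rfl).2
  have hEn : E n (Z n) = ∑ t ∈ Icc 1 n, ∑ k ∈ oddBelow t, W t k * logInvSinSq k (Z n) t := by
    refine sum_congr rfl fun t ht => sum_congr rfl fun k _ => ?_
    rw [digitMean, if_pos (mem_Icc.mp ht).2]
  simp only [mul_sub, sum_sub_distrib]
  rw [hEn] at hfin
  linarith

/-- Splits the nonzero residues by their 2-adic valuation: `k = 2 ^ (n - t) * odd` reduces to level
`t`. -/
theorem sum_Icc_two_pow_eq_sum_oddBelow (n : ℕ) (f : ℕ → ℕ → ℝ)
    (hf : ∀ k t, f (2 * k) (t + 1) = f k t) :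
    ∑ k ∈ Icc 1 (2 ^ n - 1), f k n = ∑ t ∈ Icc 1 n, ∑ k ∈ oddBelow t, f k t := by
  induction n with
  | zero => simp
  | succ n ih =>
    have hI : Icc 1 (n + 1) = insert (n + 1) (Icc 1 n) := by
      ext; simp only [mem_insert, mem_Icc]; omega
    rw [hI, sum_insert (by simp), ← ih, oddBelow,
      ← sum_filter_add_sum_filter_not (Icc 1 (2 ^ (n + 1) - 1)) (fun k => k % 2 = 1)]
    congr 1
    have hp : 2 ^ (n + 1) = 2 * 2 ^ n := by ring
    have hpos : 0 < 2 ^ n := by positivity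
    refine sum_nbij' (fun k => k / 2) (fun k => 2 * k) ?_ ?_ ?_ ?_ ?_
    · intro k hk; rw [mem_filter, mem_Icc] at hk; rw [mem_Icc]; omega
    · intro k hk; rw [mem_Icc] at hk; rw [mem_filter, mem_Icc]; omega
    · intro k hk; rw [mem_filter] at hk; omega
    · intro k hk; omega
    · intro k hk
      rw [mem_filter] at hk
      have hk2 : 2 * (k / 2) = k := by omega
      rw [← hf (k / 2) n, hk2]

/-- Serves the first component, which is fixed to `1`. Pairing `k` with `k + 2 ^ n` gives the
duplication identity again; the term `k = 0` is `log (1 / 0) = 0`. -/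
theorem sum_range_logInvSinSq_le (n : ℕ) :
    ∑ k ∈ range (2 ^ n), logInvSinSq k 1 n ≤ (2 ^ n - 1) * Real.log 4 := by
  induction n with
  | zero => simp [logInvSinSq]
  | succ n ih =>
    rw [show 2 ^ (n + 1) = 2 ^ n + 2 ^ n by ring, sum_range_add, ← sum_add_distrib]
    have hpos : 0 < 2 ^ n := by positivity
    have key : ∀ k ∈ range (2 ^ n), logInvSinSq k 1 (n + 1) + logInvSinSq (2 ^ n + k) 1 (n + 1)
        ≤ logInvSinSq k 1 n + (if k = 0 then 0 else Real.log 4) := by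
      intro k hk
      rw [mem_range] at hk
      unfold logInvSinSq
      have e1 : Real.pi * ((2 ^ n + k : ℕ) : ℝ) * ((1 : ℤ) : ℝ) / 2 ^ (n + 1)
          = Real.pi * (k : ℝ) * ((1 : ℤ) : ℝ) / 2 ^ (n + 1) + Real.pi / 2 := by
        push_cast
        field_simp
        ring
      rw [e1, Real.sin_add_pi_div_two]
      split_ifs with h0
      · subst h0
        simp
      · have e2 : Real.pi * (k : ℝ) * ((1 : ℤ) : ℝ) / 2 ^ n
            = 2 * (Real.pi * (k : ℝ) * ((1 : ℤ) : ℝ) / 2 ^ (n + 1)) := by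
          field_simp
          ring
        rw [e2]
        refine (log_inv_sin_sq_add_log_inv_cos_sq ?_).le
        rw [← e2]
        have := sin_pi_mul_div_ne_zero (N := 2 ^ n) hpos (a := k) (by
          intro hd
          have := Nat.le_of_dvd (by omega) (by exact_mod_cast hd : 2 ^ n ∣ k)
          omega)
        convert this using 2
        push_cast
        ring
    refine (sum_le_sum key).trans ?_
    rw [sum_add_distrib]
    have : ∑ k ∈ range (2 ^ n), (if k = 0 then 0 else Real.log 4) = (2 ^ n - 1) * Real.log 4 := by
      rw [sum_ite, sum_const_zero, zero_add, sum_const, nsmul_eq_mul]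
      congr 1
      have : (range (2 ^ n)).filter (fun k => ¬ k = 0) = (range (2 ^ n)).erase 0 := by
        ext; simp [and_comm]
      rw [this, card_erase_of_mem (by simp), card_range, Nat.cast_sub hpos]
      simp
    rw [this]
    calc _ ≤ (2 ^ n - 1) * Real.log 4 + (2 ^ n - 1) * Real.log 4 := by gcongr
      _ ≤ _ := by
        have : 0 ≤ Real.log 4 := Real.log_nonneg (by norm_num)
        rw [pow_succ]
        nlinarith

theorem odd_of_isCBCDBDOutput {γ : Finset ℕ → ℝ} {n s : ℕ} (hn : 1 ≤ n) {z : ℕ → ℤ}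
    (h : IsCBCDBDOutput γ n s z) : ∀ r ∈ Icc 1 s, Odd (z r) := by
  obtain ⟨Z, h1, hr1, hr, hz⟩ := h
  intro r hrs
  rw [hz r hrs]
  rw [mem_Icc] at hrs
  rcases Nat.eq_or_lt_of_le hrs.1 with h | h
  · rw [← h, h1]; exact odd_one
  · have hr2 : r ∈ Icc 2 s := by rw [mem_Icc]; omega
    have key : ∀ v, 1 ≤ v → v ≤ n → Odd (Z r v) := by
      intro v hv
      induction v, hv using Nat.le_induction with
      | base => intro _; rw [hr1 r hr2]; exact odd_one
      | succ v hv ih =>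
        intro hvn
        obtain ⟨b, -, -, hb⟩ := hr r hr2 (v + 1) (by rw [mem_Icc]; omega)
        rw [hb, Nat.add_sub_cancel]
        have heven : Even ((2 : ℤ) ^ v) := (even_two).pow_of_ne_zero (by omega)
        exact (ih (by omega)).add_even (heven.mul_left b)
    exact key n hn le_rfl

theorem weight_union_pos {γ : Finset ℕ → ℝ} (hγ : IsPositiveWeights γ) {r : ℕ} (hr : 1 ≤ r)
    {u : Finset ℕ} (hu : u ⊆ Icc 1 (r - 1)) : 0 < γ (u ∪ {r}) := by
  refine hγ.2 _ fun h => ?_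
  rw [mem_union, mem_singleton] at h
  rcases h with h | h
  · have := hu h
    simp at this
  · omega

theorem greedy_component_le {γ : Finset ℕ → ℝ} (hγ : IsPositiveWeights γ) {n s : ℕ} (hn : 1 ≤ n)
    {z : ℕ → ℤ} (h : IsCBCDBDOutput γ n s z) {r : ℕ} (hr : r ∈ Icc 1 s) :
    ∑ k ∈ Icc 1 (2 ^ n - 1), ∑ u ∈ (Icc 1 (r - 1)).powerset, γ (u ∪ {r}) *
      ((logInvSinSq k (z r) n - Real.log 4) * ∏ j ∈ u, logInvSinSq k (z j) n) ≤ 0 := by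
  obtain ⟨Z, h1, hr1, hZ, hz⟩ := h
  rw [mem_Icc] at hr
  rcases Nat.eq_or_lt_of_le hr.1 with rfl | hr2
  · rw [hz 1 (by rw [mem_Icc]; omega), h1]
    have hγ1 : 0 ≤ γ (∅ ∪ {1}) := (weight_union_pos hγ le_rfl (empty_subset _)).le
    simp only [Nat.sub_self, Icc_eq_empty_of_lt zero_lt_one, powerset_empty, sum_singleton,
      prod_empty, mul_one]
    rw [← mul_sum]
    refine mul_nonpos_of_nonneg_of_nonpos hγ1 ?_
    have hs := sum_range_logInvSinSq_le n
    have hpos : 0 < 2 ^ n := by positivity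
    have hrange : range (2 ^ n) = insert 0 (Icc 1 (2 ^ n - 1)) := by
      ext; simp only [mem_range, mem_insert, mem_Icc]; omega
    rw [hrange, sum_insert (by simp)] at hs
    have h0 := logInvSinSq_nonneg 0 1 n
    rw [sum_sub_distrib, sum_const, Nat.card_Icc, nsmul_eq_mul, Nat.add_sub_cancel,
      Nat.cast_sub hpos]
    push_cast
    linarith
  · have hrs : r ∈ Icc 2 s := by rw [mem_Icc]; omega
    let W : ℕ → ℕ → ℝ := fun t k =>
      ∑ u ∈ (Icc 1 (r - 1)).powerset, γ (u ∪ {r}) * ∏ j ∈ u, logInvSinSq k (z j) t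
    have hW : ∀ t k, 0 ≤ W t k := fun t k => sum_nonneg fun u hu =>
      mul_nonneg (weight_union_pos hγ hr.1 (mem_powerset.mp hu)).le
        (prod_nonneg fun j _ => logInvSinSq_nonneg _ _ _)
    have hWsum : ∀ (t k : ℕ) (y : ℝ), ∑ u ∈ (Icc 1 (r - 1)).powerset, γ (u ∪ {r}) *
        (y * ∏ j ∈ u, logInvSinSq k (z j) t) = W t k * y := by
      intro t k y
      simp only [W]
      rw [sum_mul]
      exact sum_congr rfl fun u _ => by ring
    have hg := greedy_digits_le hn W hW (Z r) (hr1 r hrs) (by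
      intro v hv
      obtain ⟨b, hb, hmin, hbv⟩ := hZ r hrs v hv
      refine ⟨b, hb, ?_, hbv⟩
      -- The first group of terms does not involve `x`, so it does not affect the minimizer.
      have e : ∀ x, digitQuality γ n z r v x = (∑ t ∈ Icc v n, (1 / 2 ^ (t - v) : ℝ) *
          ∑ k ∈ oddBelow t, ∑ u ∈ (Icc 1 (r - 1)).powerset.erase ∅,
            γ u * ∏ j ∈ u, logInvSinSq k (z j) t) + ∑ t ∈ Icc v n, (1 / 2 ^ (t - v) : ℝ) *
          ∑ k ∈ oddBelow t, W t k * logInvSinSq k x v := by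
        intro x
        unfold digitQuality
        rw [← sum_add_distrib]
        refine sum_congr rfl fun t _ => ?_
        rw [← mul_add, ← sum_add_distrib]
        congr 1
        refine sum_congr rfl fun k _ => ?_
        rw [← hWsum]
        congr 1
        exact sum_congr rfl fun u _ => by ring
      rw [isMinOn_iff] at hmin ⊢
      intro c hc
      have := hmin c hc
      rw [e, e] at this
      linarith)
    rw [← hz r (by rw [mem_Icc]; omega)] at hg
    rw [sum_Icc_two_pow_eq_sum_oddBelow n (fun k t => ∑ u ∈ (Icc 1 (r - 1)).powerset, γ (u ∪ {r}) *
      ((logInvSinSq k (z r) t - Real.log 4) * ∏ j ∈ u, logInvSinSq k (z j) t))]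
    · simp only [hWsum]
      exact hg
    · intro k t
      simp only [logInvSinSq_two_mul]

/-! ### Error of replacing the truncated products, and the first bound -/

/-- Telescoping over the factors. The extra factor `B` on the left avoids the exponent `u.card - 1`.
-/
theorem mul_abs_prod_sub_prod_le {ι : Type*} [DecidableEq ι] {B : ℝ} (hB : 0 ≤ B) (X Y e : ι → ℝ)
    (u : Finset ι) (hX : ∀ j ∈ u, |X j| ≤ B) (hY : ∀ j ∈ u, |Y j| ≤ B)
    (he : ∀ j ∈ u, |X j - Y j| ≤ e j) :
    B * |∏ j ∈ u, X j - ∏ j ∈ u, Y j| ≤ B ^ u.card * ∑ j ∈ u, e j := by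
  induction u using Finset.induction_on with
  | empty => simp
  | insert a u ha ih =>
    have ih := ih (fun j hj => hX j (mem_insert_of_mem hj)) (fun j hj => hY j (mem_insert_of_mem hj))
      (fun j hj => he j (mem_insert_of_mem hj))
    have hPX : |∏ j ∈ u, X j| ≤ B ^ u.card := by
      rw [abs_prod]
      refine (prod_le_prod (fun _ _ => abs_nonneg _)
        fun j hj => hX j (mem_insert_of_mem hj)).trans (by simp)
    have h1 := he a (mem_insert_self a u)
    have h2 := hY a (mem_insert_self a u)
    rw [prod_insert ha, prod_insert ha, sum_insert ha, card_insert_of_notMem ha]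
    have e1 : X a * ∏ j ∈ u, X j - Y a * ∏ j ∈ u, Y j
        = (X a - Y a) * ∏ j ∈ u, X j + Y a * (∏ j ∈ u, X j - ∏ j ∈ u, Y j) := by ring
    have h3 : |X a * ∏ j ∈ u, X j - Y a * ∏ j ∈ u, Y j|
        ≤ e a * B ^ u.card + B * |∏ j ∈ u, X j - ∏ j ∈ u, Y j| := by
      rw [e1]
      refine (abs_add_le _ _).trans ?_
      rw [abs_mul, abs_mul]
      have : 0 ≤ e a := (abs_nonneg _).trans h1
      gcongr
    calc _ ≤ B * (e a * B ^ u.card + B ^ u.card * ∑ j ∈ u, e j) := by gcongr; linarith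
      _ = _ := by ring

theorem mul_prod_le_mul_prod_add {ι : Type*} [DecidableEq ι] {B : ℝ} (hB : 0 ≤ B) (X Y e : ι → ℝ)
    (u : Finset ι) (hX : ∀ j ∈ u, |X j| ≤ B) (hY : ∀ j ∈ u, |Y j| ≤ B)
    (he : ∀ j ∈ u, |X j - Y j| ≤ e j) {x y d : ℝ} (hy : |y| ≤ B) (hd : |x - y| ≤ d) :
    x * ∏ j ∈ u, X j ≤ y * ∏ j ∈ u, Y j + B ^ u.card * (d + ∑ j ∈ u, e j) := by
  have h := mul_abs_prod_sub_prod_le hB X Y e u hX hY he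
  have hPX : |∏ j ∈ u, X j| ≤ B ^ u.card := by
    rw [abs_prod]
    exact (prod_le_prod (fun _ _ => abs_nonneg _) hX).trans (by simp)
  have h1 : (x - y) * ∏ j ∈ u, X j ≤ d * B ^ u.card := by
    refine (le_abs_self _).trans ?_
    rw [abs_mul]
    have : 0 ≤ d := (abs_nonneg _).trans hd
    gcongr
  have h2 : y * (∏ j ∈ u, X j - ∏ j ∈ u, Y j) ≤ B * |∏ j ∈ u, X j - ∏ j ∈ u, Y j| := by
    refine (le_abs_self _).trans ?_
    rw [abs_mul]
    gcongr
  nlinarith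

theorem cosSum_bounds {n : ℕ} (hn : 1 ≤ n) {k : ℕ} {x : ℤ}
    (hkx : ¬ ((2 ^ n : ℕ) : ℤ) ∣ k * x) :
    |cosSum (2 ^ n - 1) (((k * x : ℤ) : ℝ) / ((2 ^ n : ℕ) : ℝ)) + Real.log 4 - logInvSinSq k x n|
        ≤ 2 * (1 / (((2 ^ n : ℕ) : ℝ) *
          |Real.sin (Real.pi * (((k * x : ℤ) : ℝ) / ((2 ^ n : ℕ) : ℝ)))|)) ∧
      |logInvSinSq k x n| ≤ 10 * Real.log ((2 ^ n : ℕ) : ℝ) ∧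
      |logInvSinSq k x n - Real.log 4| ≤ 10 * Real.log ((2 ^ n : ℕ) : ℝ) := by
  have hN : 0 < 2 ^ n := by positivity
  have hM : (((2 ^ n - 1 : ℕ) : ℝ)) + 1 = ((2 ^ n : ℕ) : ℝ) := by
    rw [Nat.cast_sub hN]; simp
  have h1 := abs_cosSum_add_log_four_sub_le (2 ^ n - 1) (sin_pi_mul_div_ne_zero hN hkx)
  rw [← logInvSinSq_eq, hM, div_eq_mul_one_div (2 : ℝ)] at h1
  have h2 := inv_mul_abs_sin_le_one hN hkx
  have h3 := abs_cosSum_le (2 ^ n - 1) (((k * x : ℤ) : ℝ) / ((2 ^ n : ℕ) : ℝ))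
  rw [hM] at h3
  have hl2 : Real.log 2 ≤ Real.log ((2 ^ n : ℕ) : ℝ) := by
    apply Real.log_le_log (by norm_num)
    exact_mod_cast Nat.le_self_pow (by omega) 2
  have hl4 : Real.log 4 = 2 * Real.log 2 := by
    rw [show (4 : ℝ) = 2 ^ 2 by norm_num, Real.log_pow]; push_cast; ring
  -- The constant `10` comes from `4 + 4 log N ≤ 10 log N`, that is `4 ≤ 6 log 2`, which needs the
  -- numerical value of `log 2`.
  have hl := Real.log_two_gt_d9
  refine ⟨h1, ?_, ?_⟩
  · rw [abs_le] at *
    constructor <;> linarith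
  · rw [abs_le] at *
    constructor <;> linarith

theorem abs_cosSum_add_le {n : ℕ} (hn : 1 ≤ n) (x c : ℝ) (hc : 0 ≤ c) (hc4 : c ≤ Real.log 4) :
    |cosSum (2 ^ n - 1) x + c| ≤ 10 * Real.log ((2 ^ n : ℕ) : ℝ) := by
  have hN : 0 < 2 ^ n := by positivity
  have hM : (((2 ^ n - 1 : ℕ) : ℝ)) + 1 = ((2 ^ n : ℕ) : ℝ) := by
    rw [Nat.cast_sub hN]; simp
  have h3 := abs_cosSum_le (2 ^ n - 1) x
  rw [hM] at h3
  have hl2 : Real.log 2 ≤ Real.log ((2 ^ n : ℕ) : ℝ) := by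
    apply Real.log_le_log (by norm_num)
    exact_mod_cast Nat.le_self_pow (by omega) 2
  have hl4 : Real.log 4 = 2 * Real.log 2 := by
    rw [show (4 : ℝ) = 2 ^ 2 by norm_num, Real.log_pow]; push_cast; ring
  have hl := Real.log_two_gt_d9
  rw [abs_le] at *
  constructor <;> linarith

theorem truncT_le_of_isCBCDBDOutput {γ : Finset ℕ → ℝ} (hγ : IsPositiveWeights γ) {n s N : ℕ}
    (hn : 1 ≤ n) (hNn : N = 2 ^ n) {z : ℕ → ℤ} (hz : IsCBCDBDOutput γ n s z) :
    truncT 1 γ N s z ≤ (1 + Real.log N) *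
      ∑ u ∈ (Icc 1 s).powerset.erase ∅, γ u / N * (20 * Real.log N) ^ u.card := by
  have hN : 0 < N := by rw [hNn]; positivity
  have hNR : (0 : ℝ) < N := by exact_mod_cast hN
  have hlog : Real.log 2 ≤ Real.log N := by
    apply Real.log_le_log (by norm_num)
    rw [hNn]
    exact_mod_cast Nat.le_self_pow (by omega) 2
  have hl := Real.log_two_gt_d9
  set B := 10 * Real.log N with hBdef
  have hB0 : 2 ≤ B := by linarith
  have hodd := odd_of_isCBCDBDOutput hn hz
  have hcop : ∀ j ∈ Icc 1 s, IsCoprime (N : ℤ) (z j) := by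
    intro j hj
    rw [hNn]
    push_cast
    exact (Int.isCoprime_iff_gcd_eq_one.mpr (by
      have := hodd j hj
      rw [Int.gcd_comm]
      exact Int.isCoprime_iff_gcd_eq_one.mp (Int.isCoprime_two_right.mpr this))).pow_left
  have hnd : ∀ j ∈ Icc 1 s, ∀ k ∈ Icc 1 (N - 1), ¬ (N : ℤ) ∣ k * z j := by
    intro j hj k hk hd
    rw [mem_Icc] at hk
    have := Int.le_of_dvd (by omega) ((hcop j hj).dvd_of_dvd_mul_right hd)
    omega
  let e : ℕ → ℕ → ℝ := fun j k =>
    2 * (1 / (N * |Real.sin (Real.pi * (((k * z j : ℤ) : ℝ) / (N : ℝ)))|))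
  have he : ∀ j ∈ Icc 1 s, ∑ k ∈ Icc 1 (N - 1), e j k ≤ 2 * (1 + Real.log N) := by
    intro j hj
    simp only [e]
    rw [← mul_sum]
    exact mul_le_mul_of_nonneg_left (sum_inv_mul_sin_le hN (hcop j hj)) zero_le_two
  have hsub : ∀ r ∈ Icc 1 s, ∀ u ∈ (Icc 1 (r - 1)).powerset, ∀ j ∈ u, j ∈ Icc 1 s ∧ j < r := by
    intro r hr u hu j hj
    have := mem_powerset.mp hu hj
    rw [mem_Icc] at *
    omega
  have hlog4 : 0 ≤ Real.log 4 := Real.log_nonneg (by norm_num)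
  have hterm : ∀ r ∈ Icc 1 s, ∀ u ∈ (Icc 1 (r - 1)).powerset, ∑ k ∈ range N,
      cosSum (N - 1) (((k * z r : ℤ) : ℝ) / (N : ℝ)) *
          ∏ j ∈ u, (cosSum (N - 1) (((k * z j : ℤ) : ℝ) / (N : ℝ)) + Real.log 4)
      ≤ ∑ k ∈ Icc 1 (N - 1),
          (logInvSinSq k (z r) n - Real.log 4) * ∏ j ∈ u, logInvSinSq k (z j) n
        + (1 + Real.log N) * (2 * B) ^ (u.card + 1) := by
    intro r hr u hu
    have hrange : range N = insert 0 (Icc 1 (N - 1)) := by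
      ext; simp only [mem_range, mem_insert, mem_Icc]; omega
    rw [hrange, sum_insert (by simp)]
    -- At `k = 0` the logarithm is singular, so the truncated series is bounded trivially.
    have h0 : cosSum (N - 1) ((((0 : ℕ) * z r : ℤ) : ℝ) / (N : ℝ)) *
        ∏ j ∈ u, (cosSum (N - 1) ((((0 : ℕ) * z j : ℤ) : ℝ) / (N : ℝ)) + Real.log 4)
        ≤ B ^ (u.card + 1) := by
      refine (le_abs_self _).trans ?_
      rw [abs_mul, abs_prod, pow_succ']
      subst hNn
      refine mul_le_mul ?_ ?_ (prod_nonneg fun _ _ => abs_nonneg _) (by linarith)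
      · have := abs_cosSum_add_le hn ((((0 : ℕ) * z r : ℤ) : ℝ) / ((2 ^ n : ℕ) : ℝ)) 0 le_rfl hlog4
        rwa [add_zero] at this
      · exact (prod_le_prod (fun _ _ => abs_nonneg _)
          fun j _ => abs_cosSum_add_le hn _ _ hlog4 le_rfl).trans (by simp [hBdef])
    have h1 : ∑ k ∈ Icc 1 (N - 1), cosSum (N - 1) (((k * z r : ℤ) : ℝ) / (N : ℝ)) *
        ∏ j ∈ u, (cosSum (N - 1) (((k * z j : ℤ) : ℝ) / (N : ℝ)) + Real.log 4)
        ≤ ∑ k ∈ Icc 1 (N - 1),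
          ((logInvSinSq k (z r) n - Real.log 4) * ∏ j ∈ u, logInvSinSq k (z j) n
            + B ^ u.card * (e r k + ∑ j ∈ u, e j k)) := by
      refine sum_le_sum fun k hk => ?_
      have hb : ∀ j ∈ Icc 1 s, _ := fun j hj =>
        cosSum_bounds hn (k := k) (x := z j) (by rw [← hNn]; exact hnd j hj k hk)
      have hr' := hb r hr
      rw [← hNn] at hb hr'
      refine mul_prod_le_mul_prod_add (by linarith) _ _ _ u ?_ ?_ ?_ hr'.2.2 ?_
      · intro j _
        have := abs_cosSum_add_le hn (((k * z j : ℤ) : ℝ) / (N : ℝ)) _ hlog4 le_rfl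
        rwa [← hNn] at this
      · exact fun j hj => (hb j (hsub r hr u hu j hj).1).2.1
      · exact fun j hj => (hb j (hsub r hr u hu j hj).1).1
      · refine le_trans (le_of_eq ?_) hr'.1
        congr 1
        ring
    have h2 : ∑ k ∈ Icc 1 (N - 1), B ^ u.card * (e r k + ∑ j ∈ u, e j k)
        ≤ B ^ u.card * ((u.card + 1) * (2 * (1 + Real.log N))) := by
      rw [← mul_sum, sum_add_distrib, sum_comm]
      have h3 : ∑ j ∈ u, ∑ k ∈ Icc 1 (N - 1), e j k ≤ u.card * (2 * (1 + Real.log N)) := by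
        refine (sum_le_sum fun j hj => he j (hsub r hr u hu j hj).1).trans ?_
        simp
      have h4 := he r hr
      refine mul_le_mul_of_nonneg_left ?_ (by positivity)
      linarith
    rw [sum_add_distrib] at h1
    have h5 : B ^ (u.card + 1) + B ^ u.card * ((u.card + 1) * (2 * (1 + Real.log N)))
        ≤ (1 + Real.log N) * (2 * B) ^ (u.card + 1) := by
      -- The number of error terms is absorbed by doubling the base, whence `a = 20 = 2 * 10`.
      have hc : ((u.card : ℝ) + 1) + 1 ≤ 2 ^ (u.card + 1) := by
        exact_mod_cast Nat.lt_two_pow_self (n := u.card + 1)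
      have hBp : 0 < B ^ u.card := by positivity
      have h6 : B ^ u.card * ((u.card + 1) * (2 * (1 + Real.log N)))
          ≤ B ^ (u.card + 1) * ((u.card + 1) * (1 + Real.log N)) := by
        rw [pow_succ]
        have : 0 ≤ B ^ u.card * ((u.card + 1) * (1 + Real.log N)) := by positivity
        nlinarith
      have h7 : B ^ (u.card + 1) ≤ B ^ (u.card + 1) * (1 + Real.log N) :=
        le_mul_of_one_le_right (by positivity) (by linarith)
      calc _ ≤ (1 + Real.log N) * (((u.card : ℝ) + 1 + 1) * B ^ (u.card + 1)) := by
            linarith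
        _ ≤ (1 + Real.log N) * (2 ^ (u.card + 1) * B ^ (u.card + 1)) := by
            have : 0 ≤ 1 + Real.log N := by linarith
            gcongr
        _ = _ := by rw [mul_pow 2 B]
    linarith
  have hmain : (N : ℝ) * truncT 1 γ N s z ≤ ∑ r ∈ Icc 1 s, ∑ u ∈ (Icc 1 (r - 1)).powerset,
      γ (u ∪ {r}) * ((1 + Real.log N) * (2 * B) ^ (u ∪ {r}).card) := by
    refine (truncT_le_sum_cosSum hγ hN s z).trans (sum_le_sum fun r hr => ?_)
    have hg := greedy_component_le hγ hn hz hr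
    rw [← hNn, sum_comm] at hg
    have hstep : ∀ u ∈ (Icc 1 (r - 1)).powerset, γ (u ∪ {r}) * ∑ k ∈ range N,
        cosSum (N - 1) (((k * z r : ℤ) : ℝ) / (N : ℝ)) *
          ∏ j ∈ u, (cosSum (N - 1) (((k * z j : ℤ) : ℝ) / (N : ℝ)) + Real.log 4)
        ≤ ∑ k ∈ Icc 1 (N - 1), γ (u ∪ {r}) *
          ((logInvSinSq k (z r) n - Real.log 4) * ∏ j ∈ u, logInvSinSq k (z j) n)
        + γ (u ∪ {r}) * ((1 + Real.log N) * (2 * B) ^ (u ∪ {r}).card) := by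
      intro u hu
      have hγ0 := (weight_union_pos hγ (mem_Icc.mp hr).1 (mem_powerset.mp hu)).le
      have hcard : (u ∪ {r}).card = u.card + 1 := by
        rw [union_comm]
        exact card_insert_of_notMem fun h => lt_irrefl _ (hsub r hr u hu r h).2
      rw [← mul_sum, ← mul_add, hcard]
      exact mul_le_mul_of_nonneg_left (hterm r hr u hu) hγ0
    refine (sum_le_sum hstep).trans ?_
    rw [sum_add_distrib]
    linarith
  rw [← sum_powerset_Icc_erase_empty s
    (fun u => γ u * ((1 + Real.log N) * (2 * B) ^ u.card))] at hmain
  rw [mul_comm, ← le_div_iff₀ hNR] at hmain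
  refine hmain.trans (le_of_eq ?_)
  rw [sum_div, mul_sum]
  refine sum_congr rfl fun u _ => ?_
  rw [hBdef, ← mul_assoc 2 10]
  norm_num
  ring

/-! ### Summable weights and the second bound -/

theorem one_add_mul_le_mul_exp {x y ε : ℝ} (hx : 0 ≤ x) (hy : 0 ≤ y) (hε : 0 < ε) :
    1 + x * y ≤ (1 + x / ε) * Real.exp (ε * y) := by
  have h := Real.add_one_le_exp (ε * y)
  have h1 : 1 + x * y ≤ (1 + x / ε) * (ε * y + 1) := by
    have e : (1 + x / ε) * (ε * y + 1) = 1 + x * y + (ε * y + x / ε) := by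
      field_simp
      ring
    rw [e]
    have : 0 ≤ ε * y + x / ε := by positivity
    linarith
  exact h1.trans (mul_le_mul_of_nonneg_left h (by positivity))

/-- Beyond some `J` the tail of `g` is below `η / 2`, and `1 + t ≤ exp t` suffices. Each of the
first `J` factors grows only linearly in `y`, so it costs a constant times an exponential of small
rate. -/
theorem exists_prod_one_add_mul_le_exp {g : ℕ → ℝ} (hg : ∀ i, 0 ≤ g i) (hs : Summable g) {η : ℝ}
    (hη : 0 < η) :
    ∃ C : ℝ, 0 < C ∧ ∀ (s : ℕ) (y : ℝ), 0 ≤ y →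
      ∏ i ∈ range s, (1 + g i * y) ≤ C * Real.exp (η * y) := by
  obtain ⟨J, hJ⟩ := ((tendsto_sum_nat_add g).eventually_lt_const (half_pos hη)).exists
  -- The head then has total rate `J * ε ≤ η / 2`; `J + 1` avoids division by zero.
  set ε := η / (2 * (J + 1)) with hε
  have hε0 : 0 < ε := by positivity
  refine ⟨∏ i ∈ range J, (1 + g i / ε), prod_pos fun i _ => ?_, fun s y hy => ?_⟩
  · have := hg i
    positivity
  have h1 : ∏ i ∈ range J, (1 + g i * y)
      ≤ (∏ i ∈ range J, (1 + g i / ε)) * Real.exp (η / 2 * y) := by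
    calc _ ≤ ∏ i ∈ range J, ((1 + g i / ε) * Real.exp (ε * y)) := by
          refine prod_le_prod (fun i _ => ?_) fun i _ => one_add_mul_le_mul_exp (hg i) hy hε0
          have := hg i
          positivity
      _ = (∏ i ∈ range J, (1 + g i / ε)) * Real.exp (J * (ε * y)) := by
          rw [prod_mul_distrib, prod_const, card_range, ← Real.exp_nat_mul]
      _ ≤ _ := by
          have hJε : J * ε ≤ η / 2 := by
            rw [hε, ← mul_div_assoc, div_le_div_iff₀ (by positivity) (by norm_num)]
            nlinarith
          have : 0 ≤ ∏ i ∈ range J, (1 + g i / ε) := prod_nonneg fun i _ => by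
            have := hg i
            positivity
          refine mul_le_mul_of_nonneg_left (Real.exp_le_exp.mpr ?_) this
          rw [← mul_assoc]
          exact mul_le_mul_of_nonneg_right hJε hy
  have h2 : ∏ i ∈ range s, (1 + g (J + i) * y) ≤ Real.exp (η / 2 * y) := by
    calc _ ≤ ∏ i ∈ range s, Real.exp (g (J + i) * y) := by
          refine prod_le_prod (fun i _ => ?_) fun i _ => ?_
          · have := hg (J + i)
            positivity
          · have := Real.add_one_le_exp (g (J + i) * y)
            linarith
      _ = Real.exp ((∑ i ∈ range s, g (i + J)) * y) := by
          rw [← Real.exp_sum, sum_mul]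
          simp only [add_comm]
      _ ≤ _ := by
          have := ((summable_nat_add_iff J).mpr hs).sum_le_tsum (range s) fun i _ => hg (i + J)
          gcongr
          linarith
  calc _ ≤ ∏ i ∈ range (J + s), (1 + g i * y) := by
        refine Finset.prod_le_prod_of_subset_of_one_le (range_mono (by omega)) (fun i _ => ?_)
          fun i _ _ => ?_
        · have := hg i
          positivity
        · have := mul_nonneg (hg i) hy
          linarith
    _ = (∏ i ∈ range J, (1 + g i * y)) * ∏ i ∈ range s, (1 + g (J + i) * y) :=
        prod_range_add _ _ _
    _ ≤ ((∏ i ∈ range J, (1 + g i / ε)) * Real.exp (η / 2 * y)) * Real.exp (η / 2 * y) := by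
        refine mul_le_mul h1 h2 (prod_nonneg fun i _ => ?_) ?_
        · have := hg (J + i)
          positivity
        · refine mul_nonneg (prod_nonneg fun i _ => ?_) (Real.exp_pos _).le
          have := hg i
          positivity
    _ = _ := by
        rw [mul_assoc, ← Real.exp_add]
        congr 2
        ring

theorem gammaTilde_nonneg {γ : Finset ℕ → ℝ} (hγ : IsPositiveWeights γ) {j : ℕ} (hj : 1 ≤ j) :
    0 ≤ gammaTilde γ j := by
  refine le_trans ?_ (le_sup' (fun v => γ (v ∪ {j}) / γ v) (empty_mem_powerset _))
  rw [hγ.1, div_one]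
  exact (weight_union_pos hγ hj (empty_subset _)).le

/-- Adjoining the new largest element `j` to a set multiplies its weight by at most `gammaTilde γ
j`, so the sum is dominated by the product-weight case. -/
theorem sum_weights_mul_pow_le {γ : Finset ℕ → ℝ} (hγ : IsPositiveWeights γ) {y : ℝ} (hy : 0 ≤ y)
    (s : ℕ) : ∑ u ∈ (Icc 1 s).powerset, γ u * y ^ u.card
      ≤ ∏ i ∈ range s, (1 + gammaTilde γ (i + 1) * y) := by
  induction s with
  | zero => simp [hγ.1]
  | succ s ih =>
    have hI : Icc 1 (s + 1) = insert (s + 1) (Icc 1 s) := by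
      ext; simp only [mem_insert, mem_Icc]; omega
    have hn : s + 1 ∉ Icc 1 s := by simp
    rw [hI, sum_powerset_insert hn, prod_range_succ, mul_add, mul_one]
    have h0 := gammaTilde_nonneg hγ (show 1 ≤ s + 1 by omega)
    have h1 : ∑ u ∈ (Icc 1 s).powerset, γ (insert (s + 1) u) * y ^ (insert (s + 1) u).card
        ≤ (∑ u ∈ (Icc 1 s).powerset, γ u * y ^ u.card) * (gammaTilde γ (s + 1) * y) := by
      rw [sum_mul]
      refine sum_le_sum fun u hu => ?_
      have hus := mem_powerset.mp hu
      rw [card_insert_of_notMem fun h => hn (hus h)]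
      have hpos : 0 < γ u := hγ.2 u fun h => by simpa using hus h
      have h2 : γ (insert (s + 1) u) ≤ gammaTilde γ (s + 1) * γ u := by
        rw [← div_le_iff₀ hpos, insert_eq, union_comm]
        exact le_sup' (fun v => γ (v ∪ {s + 1}) / γ v) hu
      calc _ ≤ gammaTilde γ (s + 1) * γ u * y ^ (u.card + 1) := by gcongr
        _ = _ := by ring
    have h3 := mul_le_mul_of_nonneg_right ih (mul_nonneg h0 hy)
    linarith

theorem theorem4 :
    (∃ a : ℝ, 0 < a ∧
      ∀ γ : Finset ℕ → ℝ, IsPositiveWeights γ →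
        ∀ n s N : ℕ, 1 ≤ n → 1 ≤ s → N = 2 ^ n →
          ∀ z : ℕ → ℤ, IsCBCDBDOutput γ n s z →
            truncT 1 γ N s z ≤
              (1 + Real.log N) *
                ∑ u ∈ (Finset.Icc 1 s).powerset.erase ∅,
                  γ u / N * (a * Real.log N) ^ u.card) ∧
    (∀ γ : Finset ℕ → ℝ, IsPositiveWeights γ →
      Summable (fun i : ℕ => gammaTilde γ (i + 1)) →
        ∀ δ : ℝ, 0 < δ → ∃ C : ℝ, 0 < C ∧
          ∀ n s N : ℕ, 1 ≤ n → 1 ≤ s → N = 2 ^ n →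
            ∀ z : ℕ → ℤ, IsCBCDBDOutput γ n s z →
              truncT 1 γ N s z ≤ C / (N : ℝ) ^ (1 - δ)) := by
  refine ⟨⟨20, by norm_num, fun γ hγ n s N hn _ hN z hz =>
    truncT_le_of_isCBCDBDOutput hγ hn hN hz⟩, fun γ hγ hsum δ hδ => ?_⟩
  -- With `y = 20 log N`, the rate `δ / 40` gives `N ^ (δ / 2)`; the other half of `δ` absorbs `1 +
  -- log N`.
  obtain ⟨C, hC, hprod⟩ := exists_prod_one_add_mul_le_exp
    (fun i => gammaTilde_nonneg hγ (Nat.le_add_left 1 i)) hsum (η := δ / 40) (by positivity)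
  refine ⟨(1 + 1 / (δ / 2)) * C, by positivity, fun n s N hn _ hN z hz => ?_⟩
  have hN1 : 1 ≤ N := by rw [hN]; exact Nat.one_le_two_pow
  have hNR : (0 : ℝ) < N := by exact_mod_cast hN1
  have hlog : 0 ≤ Real.log N := Real.log_nonneg (by exact_mod_cast hN1)
  have h1 := truncT_le_of_isCBCDBDOutput hγ hn hN hz
  have h2 : ∑ u ∈ (Icc 1 s).powerset.erase ∅, γ u / N * (20 * Real.log N) ^ u.card
      ≤ C * Real.exp (δ / 2 * Real.log N) / N := by
    have h3 := hprod s (20 * Real.log N) (by positivity)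
    have h4 := sum_weights_mul_pow_le hγ (y := 20 * Real.log N) (by positivity) s
    have h5 : ∑ u ∈ (Icc 1 s).powerset.erase ∅, γ u * (20 * Real.log N) ^ u.card
        ≤ ∑ u ∈ (Icc 1 s).powerset, γ u * (20 * Real.log N) ^ u.card := by
      refine sum_le_sum_of_subset_of_nonneg (erase_subset _ _) fun u hu _ => ?_
      have : 0 < γ u := hγ.2 u fun h => by simpa using mem_powerset.mp hu h
      positivity
    have e : δ / 40 * (20 * Real.log N) = δ / 2 * Real.log N := by ring
    rw [e] at h3
    rw [le_div_iff₀ hNR, sum_mul]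
    refine le_trans (le_of_eq (sum_congr rfl fun u _ => ?_)) (h5.trans (h4.trans h3))
    field_simp
  have h6 := one_add_mul_le_mul_exp zero_le_one hlog (half_pos hδ)
  rw [one_mul] at h6
  calc _ ≤ ((1 + 1 / (δ / 2)) * Real.exp (δ / 2 * Real.log N)) *
        (C * Real.exp (δ / 2 * Real.log N) / N) :=
        h1.trans (mul_le_mul h6 h2 (sum_nonneg fun u hu => ?_) (by positivity))
    _ = (1 + 1 / (δ / 2)) * C * Real.exp (δ * Real.log N) / N := by
        rw [show δ * Real.log N = δ / 2 * Real.log N + δ / 2 * Real.log N by ring, Real.exp_add]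
        ring
    _ = _ := by
        rw [Real.rpow_sub hNR, Real.rpow_one, Real.rpow_def_of_pos hNR, mul_comm (Real.log N)]
        field_simp
  have : 0 < γ u := hγ.2 u fun h => by simpa using mem_powerset.mp (mem_of_mem_erase hu) h
  positivity
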